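/- Let $q$ be a prime power, let $m$ and $\ell$ be positive integers, and let $1\le r\le m$. An $[n,k]_q$ code is a $k$-dimensional subspace $C$ of $\mathbb F_q^n$. A projective two-weight $[n,k]_q$ code with weights $w_1\neq w_2$ is an $[n,k]_q$ code of the form $C=\{(x\cdot y_1,\dots,x\cdot y_n)\mid x\in\mathbb F_q^k\}$, with $y_1,\dots,y_n\in\mathbb F_q^k$ pairwise linearly independent, such that the set of nonzero Hamming weights of words of $C$ is exactly $\{w_1,w_2\}$. Then the following exist. (1) A projective two-weight $[n_r,m(2\ell+1)]_q$ code with weights $w_{r,1}$ and $w_{r,2}$, where $$n_r=\frac{(q^r-1)(q^{m\ell}-1)(q^{m(\ell+1)}-1)}{(q-1)(q^m-1)}+\frac{q^{m\ell}-1}{q-1},$$ $$w_{r,1}=\frac{q^{m\ell-1}\left(q^{m(\ell+1)+r}-q^{m(\ell+1)}+q^m-q^r\right)}{q^m-1},\qquad w_{r,2}=\frac{q^{m(\ell+1)-1}(q^r-1)(q^{m\ell}-1)}{q^m-1}.$$ (2) A projective two-weight $[n_r^+,m(2\ell+1)]_q$ code with weights $w_{r,1}^+$ and $w_{r,2}^+$,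 where $$n_r^+=\frac{(q^m-q^{m-r})(q^{m\ell}-1)(q^{m(\ell+1)}-1)}{(q-1)(q^m-1)}+\frac{q^{m(\ell+1)}-1}{q-1},$$ $$w_{r,1}^+=\frac{q^{m(\ell+1)-r-1}\left(q^{m(\ell+1)+r}-q^{m(\ell+1)}+q^m-q^r\right)}{q^m-1},$$ $$w_{r,2}^+=\frac{(q^r-1)(q^{m(\ell+1)}-1)\left(q^{m(\ell+1)-r}-q^{m(\ell+1)-r-1}\right)}{(q-1)(q^m-1)}.$$ Moreover, for $\ell=1$ the parameters in (1) are those of the Bierbrauer–Edel codes: dimension $3m$, length $n_r=\frac{q^r(q^m-1)(q^m-q^{m-r}+1)}{q-1}$, and weights $w_{r,1}=q^{m+r-1}(q^m-q^{m-r}+1)$ and $w_{r,2}=q^{2m+r-1}-q^{2m-1}$. -/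

import Mathlib

/-- The code `{(x · y₁, …, x · yₙ) ∣ x ∈ F^k}` in `F^n` attached to vectors `y₁, …, yₙ ∈ F^k`,
where `·` is the usual dot product. -/
def codeOf {F : Type*} [Field F] {n k : ℕ} (y : Fin n → (Fin k → F)) :
    Submodule F (Fin n → F) where
  carrier := {c | ∃ x : Fin k → F, c = fun i => x ⬝ᵥ y i}
  zero_mem' := ⟨0, by funext i; simp⟩
  add_mem' := by
    rintro _ _ ⟨x, rfl⟩ ⟨z, rfl⟩
    exact ⟨x + z, by funext i; simp [add_dotProduct]⟩
  smul_mem' := by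
    rintro a _ ⟨x, rfl⟩
    exact ⟨a • x, by funext i; simp [smul_dotProduct]⟩

/-- The linear code `C ⊆ F^n` is a two-weight code with weights `w₁ ≠ w₂`: the nonzero Hamming
weights of its words are precisely `w₁` and `w₂`. -/
def IsTwoWeightCode {F : Type*} [Field F] [DecidableEq F] {n : ℕ}
    (C : Submodule F (Fin n → F)) (w₁ w₂ : ℕ) : Prop :=
  w₁ ≠ w₂ ∧ {w : ℕ | w ≠ 0 ∧ ∃ c ∈ C, hammingNorm c = w} = {w₁, w₂}

/-- `C` is a projective two-weight `[n, k]` code over `F` with weights `w₁` and `w₂`. -/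
def IsProjectiveTwoWeightCode {F : Type*} [Field F] [DecidableEq F] {n : ℕ} (k : ℕ)
    (C : Submodule F (Fin n → F)) (w₁ w₂ : ℕ) : Prop :=
  Module.finrank F C = k ∧
  (∃ y : Fin n → (Fin k → F), C = codeOf y ∧
    ∀ i j : Fin n, i ≠ j → LinearIndependent F ![y i, y j]) ∧
  IsTwoWeightCode C w₁ w₂

/-- The length `n_r`. -/
def codeLength (q m ℓ r : ℕ) : ℚ :=
  ((q : ℚ) ^ r - 1) * ((q : ℚ) ^ (m * ℓ) - 1) * ((q : ℚ) ^ (m * (ℓ + 1)) - 1) /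
      (((q : ℚ) - 1) * ((q : ℚ) ^ m - 1))
    + ((q : ℚ) ^ (m * ℓ) - 1) / ((q : ℚ) - 1)

/-- The weight `w_{r,1}`. -/
def codeWeightOne (q m ℓ r : ℕ) : ℚ :=
  (q : ℚ) ^ (m * ℓ - 1) *
      ((q : ℚ) ^ (m * (ℓ + 1) + r) - (q : ℚ) ^ (m * (ℓ + 1)) + (q : ℚ) ^ m - (q : ℚ) ^ r) /
    ((q : ℚ) ^ m - 1)

/-- The weight `w_{r,2}`. -/
def codeWeightTwo (q m ℓ r : ℕ) : ℚ :=
  (q : ℚ) ^ (m * (ℓ + 1) - 1) * ((q : ℚ) ^ r - 1) * ((q : ℚ) ^ (m * ℓ) - 1) /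
    ((q : ℚ) ^ m - 1)

/-- The length `n_r^+`. -/
def dualCodeLength (q m ℓ r : ℕ) : ℚ :=
  ((q : ℚ) ^ m - (q : ℚ) ^ (m - r)) * ((q : ℚ) ^ (m * ℓ) - 1) *
        ((q : ℚ) ^ (m * (ℓ + 1)) - 1) /
      (((q : ℚ) - 1) * ((q : ℚ) ^ m - 1))
    + ((q : ℚ) ^ (m * (ℓ + 1)) - 1) / ((q : ℚ) - 1)

/-- The weight `w_{r,1}^+`. -/
def dualCodeWeightOne (q m ℓ r : ℕ) : ℚ :=
  (q : ℚ) ^ (m * (ℓ + 1) - r - 1) *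
      ((q : ℚ) ^ (m * (ℓ + 1) + r) - (q : ℚ) ^ (m * (ℓ + 1)) + (q : ℚ) ^ m - (q : ℚ) ^ r) /
    ((q : ℚ) ^ m - 1)

/-- The weight `w_{r,2}^+`. -/
def dualCodeWeightTwo (q m ℓ r : ℕ) : ℚ :=
  ((q : ℚ) ^ r - 1) * ((q : ℚ) ^ (m * (ℓ + 1)) - 1) *
      ((q : ℚ) ^ (m * (ℓ + 1) - r) - (q : ℚ) ^ (m * (ℓ + 1) - r - 1)) /
    (((q : ℚ) - 1) * ((q : ℚ) ^ m - 1))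

/-! A scaling-stable set S of nonzero vectors in an F-space V gives a projective code: the points of
S are the columns, functionals f are the messages, and the weight counts the points of S off ker f
(`exists_isProjectiveTwoWeightCode`). Averaging over scalars makes this weight an affine function of
the character sum ∑ ψ(f s) over s ∈ S (`card_mul_card_filter_ne_zero`), so a set whose character
sums take two values is needed.

Let K = F_{q^m}, let A and B be its extensions of degrees ℓ and ℓ + 1, and let U be an F-subspace of
K of dimension r. Take S to be the set of (a, b) ∈ A × B with a ≠ 0 and N(b)/N(a) ∈ U. The degrees
differ by one, so N(b)/N(a) scales linearly under F. Write f as Tr(αa) + Tr(βb) and split the sum by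
c = N(b)/N(a). The Davenport–Hasse relation G_B = -G_K G_A, used for all multiplicative characters
at once by taking coefficients in a monoid algebra, turns a trace sum over a norm fibre of B into a
sum over the units of A. Orthogonality on A then evaluates the part with fixed c ≠ 0 as -|A| χ(cδ) -
κ, where χ = ψ ∘ Tr, δ depends only on α and β, and κ = (|A| - 1)/(|K| - 1)
(`normPairSum_of_ne_zero`). Over c ∈ U the values χ(cδ) add up to |U| or 0, which gives two values;
the degenerate cases α = 0 and β = 0 reproduce the same two (`card_normCone_filter`).

For (2), take dim U = m - r and pass to the complement of S in V \ {0}. -/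

open Polynomial in
theorem Polynomial.finite_setOf_natDegree_le (K : Type*) [Field K] [Finite K] (n : ℕ) :
    {f : K[X] | f.natDegree ≤ n}.Finite := by
  have : Finite (degreeLT K (n + 1)) :=
    Finite.of_equiv _ (degreeLTEquiv K (n + 1)).symm.toEquiv
  refine (Set.toFinite (degreeLT K (n + 1) : Set K[X])).subset fun f hf => ?_
  rw [SetLike.mem_coe, mem_degreeLT]
  exact lt_of_le_of_lt degree_le_natDegree (by exact_mod_cast Nat.lt_succ_of_le hf)

open Polynomial in
/-- The monic polynomials of degree `n` over a finite field. -/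
noncomputable def monicsOfDegree (K : Type*) [Field K] [Finite K] (n : ℕ) : Finset K[X] :=
  ((finite_setOf_natDegree_le K n).subset
    (fun _ hf => hf.2.le : {f : K[X] | f.Monic ∧ f.natDegree = n} ⊆ _)).toFinset

open Polynomial in
/-- The monic irreducible polynomials of degree at most `n` over a finite field. -/
noncomputable def monicIrreducibles (K : Type*) [Field K] [Finite K] (n : ℕ) : Finset K[X] :=
  ((finite_setOf_natDegree_le K n).subset
    (fun _ hf => hf.2.2 :
      {f : K[X] | f.Monic ∧ Irreducible f ∧ f.natDegree ≤ n} ⊆ _)).toFinset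

/-! ### Multiplicative functions on monic polynomials and sums over prime powers. -/

section DavenportHasse
open Polynomial

theorem map_pow_of_map_mul_monic {K R : Type*} [Field K] [CommRing R] (l : K[X] → R) (hl1 : l 1 = 1)
    (hl : ∀ f g : K[X], f.Monic → g.Monic → l (f * g) = l f * l g) {p : K[X]} (hp : p.Monic)
    (j : ℕ) : l (p ^ j) = l p ^ j := by
  induction j with
  | zero => simpa using hl1
  | succ j ih => rw [pow_succ, hl _ _ (hp.pow j) hp, ih, pow_succ]

variable {K : Type*} [Field K] [Finite K]

theorem mem_monicsOfDegree {n : ℕ} {f : K[X]} :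
    f ∈ monicsOfDegree K n ↔ f.Monic ∧ f.natDegree = n := by
  simp [monicsOfDegree]

theorem mem_monicIrreducibles {n : ℕ} {f : K[X]} :
    f ∈ monicIrreducibles K n ↔ f.Monic ∧ Irreducible f ∧ f.natDegree ≤ n := by
  simp [monicIrreducibles]

open scoped Classical in
/-- Each monic irreducible factor `P` contributes its degree once for every power `P ^ j`
dividing `f`. -/
theorem natDegree_eq_sum_prime_powers {n : ℕ} {f : K[X]} (hf : f ∈ monicsOfDegree K n) :
    n = ∑ P ∈ monicIrreducibles K n, ∑ j ∈ Finset.Icc 1 n,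
      if P ^ j ∣ f then P.natDegree else 0 := by
  obtain ⟨hfm, rfl⟩ := mem_monicsOfDegree.1 hf
  have hf0 := hfm.ne_zero
  have hprod : (UniqueFactorizationMonoid.normalizedFactors f).prod = f := by
    rw [UniqueFactorizationMonoid.prod_normalizedFactors_eq hf0, hfm.normalize_eq_self]
  have hmem : ∀ P ∈ UniqueFactorizationMonoid.normalizedFactors f,
      P ∈ monicIrreducibles K f.natDegree := fun P hP => by
    have hirr := UniqueFactorizationMonoid.irreducible_of_normalized_factor P hP
    refine mem_monicIrreducibles.2 ⟨?_, hirr, natDegree_le_of_dvd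
      (UniqueFactorizationMonoid.dvd_of_mem_normalizedFactors hP) hf0⟩
    rw [← UniqueFactorizationMonoid.normalize_normalized_factor P hP]
    exact monic_normalize hirr.ne_zero
  have h1 : f.natDegree =
      ((UniqueFactorizationMonoid.normalizedFactors f).map natDegree).sum := by
    conv_lhs => rw [← hprod]
    refine natDegree_multiset_prod _ fun h => ?_
    exact (UniqueFactorizationMonoid.irreducible_of_normalized_factor _ h).ne_zero rfl
  have h2 : ((UniqueFactorizationMonoid.normalizedFactors f).map natDegree).sum =
      ∑ P ∈ monicIrreducibles K f.natDegree,
        (UniqueFactorizationMonoid.normalizedFactors f).count P * P.natDegree := by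
    rw [Finset.sum_multiset_map_count]
    simp only [smul_eq_mul]
    refine Finset.sum_subset (fun P hP => hmem P (Multiset.mem_toFinset.1 hP)) fun P _ hP => ?_
    rw [Multiset.count_eq_zero.2 (fun h => hP (Multiset.mem_toFinset.2 h)), zero_mul]
  refine (h1.trans h2).trans (Finset.sum_congr rfl fun P hP => ?_)
  obtain ⟨hPm, hPi, hPd⟩ := mem_monicIrreducibles.1 hP
  rw [← Finset.sum_filter, Finset.sum_const, smul_eq_mul]
  congr 1
  have hcount : ∀ j, P ^ j ∣ f ↔
      j ≤ (UniqueFactorizationMonoid.normalizedFactors f).count P := fun j => by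
    rw [pow_dvd_iff_le_emultiplicity,
      UniqueFactorizationMonoid.emultiplicity_eq_count_normalizedFactors hPi hf0,
      hPm.normalize_eq_self]
    exact_mod_cast Iff.rfl
  simp only [hcount]
  have hle : (UniqueFactorizationMonoid.normalizedFactors f).count P ≤ f.natDegree := by
    have hdvd := (hcount _).2 le_rfl
    have := natDegree_le_of_dvd hdvd hf0
    rw [natDegree_pow] at this
    exact (Nat.le_mul_of_pos_right _ hPi.natDegree_pos).trans this
  have : {j ∈ Finset.Icc 1 f.natDegree |
      j ≤ (UniqueFactorizationMonoid.normalizedFactors f).count P} =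
      Finset.Icc 1 ((UniqueFactorizationMonoid.normalizedFactors f).count P) := by
    ext j
    simp only [Finset.mem_filter, Finset.mem_Icc]
    omega
  rw [this, Nat.card_Icc, Nat.add_sub_cancel]

variable {R : Type*} [CommRing R]

open scoped Classical in
-- The monic multiples of p of degree n are the products p * g with g monic of degree n - deg p.
theorem sum_monicsOfDegree_filter_dvd (l : K[X] → R)
    (hl : ∀ f g : K[X], f.Monic → g.Monic → l (f * g) = l f * l g) (n : ℕ) {p : K[X]}
    (hp : p.Monic) :
    ∑ f ∈ monicsOfDegree K n with p ∣ f, l f =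
      if p.natDegree ≤ n then l p * ∑ g ∈ monicsOfDegree K (n - p.natDegree), l g else 0 := by
  split_ifs with h
  · rw [Finset.mul_sum]
    symm
    refine Finset.sum_bij (fun g _ => p * g) ?_ ?_ ?_ ?_
    · intro g hg
      obtain ⟨hgm, hgd⟩ := mem_monicsOfDegree.1 hg
      rw [Finset.mem_filter, mem_monicsOfDegree, hp.natDegree_mul hgm, hgd]
      exact ⟨⟨hp.mul hgm, by omega⟩, dvd_mul_right _ _⟩
    · intro g _ g' _ h
      exact mul_left_cancel₀ hp.ne_zero h
    · intro f hf
      rw [Finset.mem_filter, mem_monicsOfDegree] at hf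
      obtain ⟨⟨hfm, hfd⟩, g, rfl⟩ := hf
      have hgm := hp.of_mul_monic_left hfm
      refine ⟨g, mem_monicsOfDegree.2 ⟨hgm, ?_⟩, rfl⟩
      rw [hp.natDegree_mul hgm] at hfd
      omega
    · intro g hg
      exact (hl p g hp (mem_monicsOfDegree.1 hg).1).symm
  · refine Finset.sum_eq_zero fun f hf => ?_
    rw [Finset.mem_filter, mem_monicsOfDegree] at hf
    exact absurd (hf.1.2 ▸ natDegree_le_of_dvd hf.2 hf.1.1.ne_zero) h

/-- Newton's identity for a completely multiplicative function on monic polynomials: the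
logarithmic derivative of its generating function. -/
theorem newton_identity (l : K[X] → R) (hl1 : l 1 = 1)
    (hl : ∀ f g : K[X], f.Monic → g.Monic → l (f * g) = l f * l g) (n : ℕ) :
    n • ∑ f ∈ monicsOfDegree K n, l f =
      ∑ P ∈ monicIrreducibles K n, ∑ j ∈ Finset.Icc 1 n,
        if j * P.natDegree ≤ n then
          P.natDegree • (l P ^ j * ∑ g ∈ monicsOfDegree K (n - j * P.natDegree), l g)
        else 0 := by
  classical
  have h1 : n • ∑ f ∈ monicsOfDegree K n, l f = ∑ f ∈ monicsOfDegree K n,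
      ∑ P ∈ monicIrreducibles K n, ∑ j ∈ Finset.Icc 1 n,
        if P ^ j ∣ f then P.natDegree • l f else 0 := by
    rw [Finset.smul_sum]
    refine Finset.sum_congr rfl fun f hf => ?_
    conv_lhs => rw [natDegree_eq_sum_prime_powers hf]
    simp only [Finset.sum_smul, ite_smul, zero_smul]
  rw [h1, Finset.sum_comm]
  refine Finset.sum_congr rfl fun P hP => ?_
  obtain ⟨hPm, -, -⟩ := mem_monicIrreducibles.1 hP
  rw [Finset.sum_comm]
  refine Finset.sum_congr rfl fun j _ => ?_
  rw [← Finset.sum_filter, ← Finset.smul_sum,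
    sum_monicsOfDegree_filter_dvd l hl n (hPm.pow j), natDegree_pow,
    map_pow_of_map_mul_monic l hl1 hl hPm, smul_ite, smul_zero]

/-- The sum over prime powers of degree `i` of a multiplicative function on monic polynomials. -/
noncomputable def primePowerSum (l : K[X] → R) (n i : ℕ) : R :=
  ∑ P ∈ monicIrreducibles K n, ∑ j ∈ Finset.Icc 1 n,
    if j * P.natDegree = i then P.natDegree • l P ^ j else 0

/-- If the sums over monic polynomials of degree at least two vanish, then the sums over prime
powers satisfy a two-term recursion. -/
theorem primePowerSum_recursion (l : K[X] → R) (hl1 : l 1 = 1)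
    (hl : ∀ f g : K[X], f.Monic → g.Monic → l (f * g) = l f * l g)
    (h0 : ∀ n, 2 ≤ n → ∑ f ∈ monicsOfDegree K n, l f = 0) {n : ℕ} (hn : 2 ≤ n) :
    primePowerSum l n n = - (∑ f ∈ monicsOfDegree K 1, l f) * primePowerSum l n (n - 1) := by
  have hM0 : ∑ f ∈ monicsOfDegree K 0, l f = 1 := by
    have : monicsOfDegree K 0 = {1} := by
      ext f
      rw [mem_monicsOfDegree, Finset.mem_singleton]
      exact ⟨fun h => eq_one_of_monic_natDegree_zero h.1 h.2, by rintro rfl; simp⟩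
    rw [this, Finset.sum_singleton, hl1]
  have h := newton_identity l hl1 hl n
  rw [h0 n hn, smul_zero] at h
  -- The inner sum over degree n - j deg P vanishes unless that degree is 0, where it is 1, or 1,
  -- where it is the constant of the recursion.
  have key : ∀ P ∈ monicIrreducibles K n, ∀ j ∈ Finset.Icc 1 n,
      (if j * P.natDegree ≤ n then
          P.natDegree • (l P ^ j * ∑ g ∈ monicsOfDegree K (n - j * P.natDegree), l g)
        else 0) =
      (if j * P.natDegree = n then P.natDegree • l P ^ j else 0) +
        (∑ f ∈ monicsOfDegree K 1, l f) *
          (if j * P.natDegree = n - 1 then P.natDegree • l P ^ j else 0) := by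
    intro P _ j _
    rcases lt_trichotomy (j * P.natDegree) (n - 1) with h | h | h
    · rw [if_pos (by omega), h0 _ (by omega), if_neg (by omega), if_neg (by omega)]
      simp
    · rw [if_pos (by omega), if_neg (by omega), if_pos h,
        show n - j * P.natDegree = 1 by omega, mul_comm (l P ^ j), mul_smul_comm, zero_add]
    · by_cases h' : j * P.natDegree = n
      · rw [if_pos h'.le, if_pos h', if_neg (by omega), h', Nat.sub_self, hM0]
        simp
      · rw [if_neg (by omega), if_neg h', if_neg (by omega)]
        simp
  rw [Finset.sum_congr rfl fun P hP => Finset.sum_congr rfl (key P hP)] at h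
  simp only [Finset.sum_add_distrib, ← Finset.mul_sum] at h
  rw [neg_mul]
  exact eq_neg_of_add_eq_zero_left h.symm

variable {L : Type*} [Field L] [Fintype L] [Algebra K L]

/-- Since deg P divides [L : K], P divides X^|L| - X and so splits in L; its roots are distinct
because finite fields are perfect. -/
theorem card_filter_minpoly_eq [DecidableEq K[X]] {P : K[X]} (hPm : P.Monic)
    (hPi : Irreducible P) (hd : P.natDegree ∣ Module.finrank K L) :
    ({a : L | minpoly K a = P} : Finset L).card = P.natDegree := by
  classical
  have hsplit : (P.map (algebraMap K L)).Splits := by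
    have h1 := hPi.natDegree_dvd_iff_dvd_X_pow_card_pow_sub_X.1 hd
    have h2 := FiniteField.isSplittingField_sub L K
    rw [Fintype.card_eq_nat_card, Module.natCard_eq_pow_finrank (K := K)] at h2
    refine h2.splits.of_dvd ?_ (Polynomial.map_dvd _ h1)
    refine Polynomial.map_ne_zero (FiniteField.X_pow_card_pow_sub_X_ne_zero _ ?_
      Finite.one_lt_card)
    exact Module.finrank_pos.ne'
  have hsep : P.Separable := PerfectField.separable_of_irreducible hPi
  rw [← card_rootSet_eq_natDegree hsep hsplit, ← Set.toFinset_card]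
  congr 1
  ext a
  rw [Finset.mem_filter, Set.mem_toFinset, mem_rootSet]
  refine ⟨?_, fun h => ⟨Finset.mem_univ _,
    (minpoly.eq_of_irreducible_of_monic hPi h.2 hPm).symm⟩⟩
  rintro ⟨-, rfl⟩
  exact ⟨hPm.ne_zero, minpoly.aeval K a⟩

/-- A sum over the elements of an extension of degree `i` is a sum over prime powers of degree
`i`. -/
theorem sum_minpoly_eq_primePowerSum (l : K[X] → R) {n i : ℕ} (hi : Module.finrank K L = i)
    (hin : i ≤ n) :
    ∑ a : L, l (minpoly K a) ^ (i / (minpoly K a).natDegree) = primePowerSum l n i := by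
  classical
  have hint : ∀ a : L, IsIntegral K a := fun a => Algebra.IsIntegral.isIntegral a
  have hipos : 0 < i := hi ▸ Module.finrank_pos
  have hdvd : ∀ a : L, (minpoly K a).natDegree ∣ i := fun a => hi ▸ minpoly.degree_dvd (hint a)
  rw [← Finset.sum_fiberwise_of_maps_to (g := fun a : L => minpoly K a)
    (t := monicIrreducibles K n)]
  · refine Finset.sum_congr rfl fun P hP => ?_
    obtain ⟨hPm, hPi, hPn⟩ := mem_monicIrreducibles.1 hP
    rw [Finset.sum_congr rfl (g := fun _ => l P ^ (i / P.natDegree))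
      (fun a ha => by rw [(Finset.mem_filter.1 ha).2]), Finset.sum_const]
    by_cases hd : P.natDegree ∣ i
    · rw [card_filter_minpoly_eq hPm hPi (hi ▸ hd), Finset.sum_eq_single (i / P.natDegree)]
      · rw [if_pos (Nat.div_mul_cancel hd)]
      · intro j _ hj
        rw [if_neg]
        rintro rfl
        exact hj (Nat.mul_div_cancel _ hPi.natDegree_pos).symm
      · intro h
        refine absurd (Finset.mem_Icc.2 ⟨Nat.div_pos (Nat.le_of_dvd hipos hd)
          hPi.natDegree_pos, (Nat.div_le_self _ _).trans hin⟩) h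
    · rw [Finset.sum_eq_zero fun j _ => if_neg fun h => hd ⟨j, by rw [← h, mul_comm]⟩,
        Finset.card_eq_zero.2, zero_smul]
      rw [Finset.filter_eq_empty_iff]
      rintro a - rfl
      exact hd (hdvd a)
  · intro a _
    exact mem_monicIrreducibles.2 ⟨minpoly.monic (hint a), minpoly.irreducible (hint a),
      (Nat.le_of_dvd hipos (hdvd a)).trans hin⟩

end DavenportHasse

/-! ### The Davenport–Hasse relation. -/

section Characters
open Polynomial
variable {K : Type*} [Field K] {R : Type*} [CommRing R] [Algebra ℂ R]

/-- The multiplicative function `f ↦ ψ(s) χ(p)` on monic polynomials, where `s` and `p` are the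
sum and the product of the roots of `f`. -/
noncomputable def rootCharacter (ψ : AddChar K ℂ) (χ : K →* R) (f : K[X]) : R :=
  ψ (-f.nextCoeff) • χ ((-1) ^ f.natDegree * f.coeff 0)

theorem rootCharacter_one (ψ : AddChar K ℂ) (χ : K →* R) : rootCharacter ψ χ 1 = 1 := by
  simp [rootCharacter, nextCoeff]

theorem rootCharacter_mul (ψ : AddChar K ℂ) (χ : K →* R) (f g : K[X]) (hf : f.Monic)
    (hg : g.Monic) :
    rootCharacter ψ χ (f * g) = rootCharacter ψ χ f * rootCharacter ψ χ g := by
  rw [rootCharacter, hf.nextCoeff_mul hg, hf.natDegree_mul hg, mul_coeff_zero, rootCharacter,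
    rootCharacter, smul_mul_smul_comm, ← map_mul χ, neg_add, AddChar.map_add_eq_mul, pow_add,
    mul_mul_mul_comm]

/-- Trace and norm of a are [L : K(a)] times the sum, respectively that power of the product, of the
roots of its minimal polynomial. This converts prime power sums into Gauss sums over L. -/
theorem rootCharacter_minpoly_pow (ψ : AddChar K ℂ) (χ : K →* R)
    {L : Type*} [Field L] [Finite L] [Algebra K L] (a : L) :
    rootCharacter ψ χ (minpoly K a) ^ (Module.finrank K L / (minpoly K a).natDegree) =
      ψ (Algebra.trace K L a) • χ (Algebra.norm K a) := by
  open IntermediateField in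
  have hint : IsIntegral K a := Algebra.IsIntegral.isIntegral a
  have hfin : Module.finrank K L / (minpoly K a).natDegree =
      Module.finrank K⟮a⟯ L := by
    rw [← IntermediateField.adjoin.finrank hint, ← Module.finrank_mul_finrank K K⟮a⟯ L]
    exact Nat.mul_div_cancel_left _ Module.finrank_pos
  rw [hfin, rootCharacter, _root_.smul_pow, trace_eq_finrank_mul_minpoly_nextCoeff,
    Algebra.norm_eq_norm_adjoin, map_pow χ, ← nsmul_eq_mul, AddChar.map_nsmul_eq_pow]
  congr 3
  rw [← IntermediateField.adjoin.powerBasis_gen hint,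
    Algebra.PowerBasis.norm_gen_eq_coeff_zero_minpoly, IntermediateField.adjoin.powerBasis_gen,
    IntermediateField.minpoly_gen, IntermediateField.adjoin.powerBasis_dim]

variable [Finite K]

/-- For n ≥ 2 the coefficient of X^(n-1) can be shifted without touching the constant term. The
shift by t multiplies the sum by a value of ψ different from 1, so the sum is zero. -/
theorem sum_monicsOfDegree_rootCharacter {ψ : AddChar K ℂ} (hψ : ψ ≠ 1) (χ : K →* R) {n : ℕ}
    (hn : 2 ≤ n) : ∑ f ∈ monicsOfDegree K n, rootCharacter ψ χ f = 0 := by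
  obtain ⟨t, ht⟩ := AddChar.ne_one_iff.1 hψ
  have hdeg : ∀ s : K, ∀ f : K[X], f.Monic → f.natDegree = n →
      (f + C s * X ^ (n - 1)).Monic ∧ (f + C s * X ^ (n - 1)).natDegree = n := by
    intro s f hfm hfd
    have hlt : (C s * X ^ (n - 1)).degree < f.degree := by
      rw [degree_eq_natDegree hfm.ne_zero, hfd]
      refine (degree_C_mul_X_pow_le _ _).trans_lt ?_
      exact_mod_cast (by omega : n - 1 < n)
    exact ⟨hfm.add_of_left hlt, by rw [natDegree_add_eq_left_of_degree_lt hlt, hfd]⟩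
  have h : ∑ f ∈ monicsOfDegree K n, rootCharacter ψ χ f =
      ψ t • ∑ f ∈ monicsOfDegree K n, rootCharacter ψ χ f := by
    rw [Finset.smul_sum]
    refine Finset.sum_nbij' (fun f => f + C t * X ^ (n - 1)) (fun f => f + C (-t) * X ^ (n - 1))
      ?_ ?_ ?_ ?_ ?_
    · intro f hf
      obtain ⟨hfm, hfd⟩ := mem_monicsOfDegree.1 hf
      exact mem_monicsOfDegree.2 (hdeg t f hfm hfd)
    · intro f hf
      obtain ⟨hfm, hfd⟩ := mem_monicsOfDegree.1 hf
      exact mem_monicsOfDegree.2 (hdeg (-t) f hfm hfd)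
    · intro f _
      simp
    · intro f _
      simp
    · intro f hf
      obtain ⟨hfm, hfd⟩ := mem_monicsOfDegree.1 hf
      obtain ⟨-, hd⟩ := hdeg t f hfm hfd
      rw [rootCharacter, rootCharacter, hd, hfd, nextCoeff_of_natDegree_pos (by omega),
        nextCoeff_of_natDegree_pos (by omega), hd, hfd, smul_smul, ← AddChar.map_add_eq_mul]
      -- Here n ≥ 2 is essential: for n = 1 the shift would alter the constant term.
      simp [show 0 ≠ n - 1 by omega]
  have h' : (1 - ψ t) • ∑ f ∈ monicsOfDegree K n, rootCharacter ψ χ f = 0 := by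
    rw [sub_smul, one_smul, ← h, sub_self]
  exact (smul_eq_zero.1 h').resolve_left (sub_ne_zero.2 (Ne.symm ht))

theorem sum_monicsOfDegree_one_rootCharacter [Fintype K] (ψ : AddChar K ℂ) (χ : K →* R) :
    ∑ f ∈ monicsOfDegree K 1, rootCharacter ψ χ f = ∑ x : K, ψ x • χ x := by
  symm
  refine Finset.sum_bij (fun x _ => X - C x) ?_ ?_ ?_ ?_
  · intro x _
    exact mem_monicsOfDegree.2 ⟨monic_X_sub_C x, natDegree_X_sub_C x⟩
  · intro x _ y _ h
    simpa using h
  · intro f hf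
    obtain ⟨hfm, hfd⟩ := mem_monicsOfDegree.1 hf
    refine ⟨-f.coeff 0, Finset.mem_univ _, ?_⟩
    conv_rhs => rw [hfm.eq_X_add_C hfd]
    simp
  · intro x _
    simp [rootCharacter]

/-- The Davenport–Hasse theorem in recursive form, for arbitrary monoid homomorphisms `χ`. -/
theorem davenportHasse_recursion [Fintype K] {ψ : AddChar K ℂ} (hψ : ψ ≠ 1) (χ : K →* R)
    {L : Type*} [Field L] [Fintype L] [Algebra K L]
    {L' : Type*} [Field L'] [Fintype L'] [Algebra K L']
    (h : Module.finrank K L' = Module.finrank K L + 1) :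
    ∑ b : L', ψ (Algebra.trace K L' b) • χ (Algebra.norm K b) =
      - (∑ x : K, ψ x • χ x) * ∑ a : L, ψ (Algebra.trace K L a) • χ (Algebra.norm K a) := by
  have hpos : 0 < Module.finrank K L := Module.finrank_pos
  have := primePowerSum_recursion (rootCharacter ψ χ) (rootCharacter_one ψ χ)
    (rootCharacter_mul ψ χ) (fun n hn => sum_monicsOfDegree_rootCharacter hψ χ hn)
    (n := Module.finrank K L') (by omega)
  rw [sum_monicsOfDegree_one_rootCharacter,
    ← sum_minpoly_eq_primePowerSum (L := L') _ rfl le_rfl,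
    ← sum_minpoly_eq_primePowerSum (L := L) _ (by omega) (by omega), h, Nat.add_sub_cancel,
    ← h] at this
  simpa only [rootCharacter_minpoly_pow] using this

end Characters

/-! ### Trace sums along the fibres of the norm. -/

section NormSums
set_option linter.unusedSectionVars false

theorem sum_addChar_trace {K : Type*} [Field K] [Fintype K] {ψ : AddChar K ℂ} (hψ : ψ ≠ 1)
    {A : Type*} [Field A] [Fintype A] [DecidableEq A] [Algebra K A] (d : A) :
    ∑ a : A, ψ (Algebra.trace K A (a * d)) = if d = 0 then (Fintype.card A : ℂ) else 0 := by
  have hprim : (ψ.compAddMonoidHom (Algebra.trace K A).toAddMonoidHom).IsPrimitive := by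
    refine AddChar.IsPrimitive.of_ne_one ?_
    obtain ⟨x, hx⟩ := AddChar.ne_one_iff.1 hψ
    obtain ⟨a, rfl⟩ := Algebra.trace_surjective K A x
    exact AddChar.ne_one_iff.2 ⟨a, hx⟩
  have := AddChar.sum_mulShift d hprim
  simpa using this

theorem card_sub_one_ne_zero {K : Type*} [Field K] [Fintype K] : (Fintype.card K : ℂ) - 1 ≠ 0 := by
  have := Fintype.one_lt_card (α := K)
  rw [sub_ne_zero]
  exact_mod_cast this.ne'

variable {K : Type*} [Field K] [Fintype K] [DecidableEq K] {ψ : AddChar K ℂ}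
  {A : Type*} [Field A] [Fintype A] [DecidableEq A] [Algebra K A]
  {B : Type*} [Field B] [Fintype B] [DecidableEq B] [Algebra K B]

theorem sum_units_eq {M : Type*} [AddCommGroup M] (f : A → M) :
    ∑ u : Aˣ, f u = ∑ a : A, f a - f 0 := by
  classical
  rw [eq_sub_iff_add_eq, ← Fintype.sum_subtype_add_sum_subtype (fun a : A => a ≠ 0) f,
    ← unitsEquivNeZero.symm.sum_comp]
  congr 1
  have : Unique {a : A // ¬ a ≠ 0} :=
    ⟨⟨⟨0, by simp⟩⟩, fun a => Subtype.ext (not_not.1 a.2)⟩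
  rw [Fintype.sum_unique]
  exact congrArg f (not_not.1 (default : {a : A // ¬ a ≠ 0}).2).symm

theorem sum_units_addChar_trace (hψ : ψ ≠ 1) (d : A) :
    ∑ u : Aˣ, ψ (Algebra.trace K A (d * u)) =
      (if d = 0 then (Fintype.card A : ℂ) else 0) - 1 := by
  rw [sum_units_eq (fun a : A => ψ (Algebra.trace K A (d * a)))]
  simp only [mul_comm d, sum_addChar_trace hψ]
  simp

/-- This is the coefficient at x of the Davenport–Hasse relation for the tautological homomorphism
from K into its monoid algebra. It replaces Fourier inversion over the multiplicative characters of
K. -/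
theorem sum_norm_fiber_addChar_trace (hψ : ψ ≠ 1)
    (h : Module.finrank K B = Module.finrank K A + 1) {x : K} (hx : x ≠ 0) :
    ∑ b : B, (if Algebra.norm K b = x then ψ (Algebra.trace K B b) else 0) =
      - ∑ a : Aˣ, ψ (x / Algebra.norm K (a : A)) * ψ (Algebra.trace K A a) := by
  have key := davenportHasse_recursion hψ (MonoidAlgebra.of ℂ K) (L := A) (L' := B) h
  rw [neg_mul, Finset.sum_mul_sum, Finset.sum_comm] at key
  have key' := DFunLike.congr_fun (congrArg MonoidAlgebra.coeff key) x
  simp only [smul_mul_smul_comm, MonoidAlgebra.coeff_sum, MonoidAlgebra.coeff_neg,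
    Finsupp.finsetSum_apply, Finsupp.neg_apply, MonoidAlgebra.coeff_smul_apply,
    MonoidAlgebra.of_apply, MonoidAlgebra.single_mul_single, MonoidAlgebra.coeff_single,
    Finsupp.single_apply, smul_eq_mul, mul_ite, mul_one,
    mul_zero] at key'
  rw [key', sum_units_eq (fun a : A => ψ (x / Algebra.norm K a) * ψ (Algebra.trace K A a)),
    ← Finset.sum_erase_eq_sub (Finset.mem_univ _),
    ← Finset.sum_erase (a := (0 : A)) Finset.univ]
  · congr 1
    refine Finset.sum_congr rfl fun a ha => ?_
    have ha : Algebra.norm K a ≠ 0 := Algebra.norm_ne_zero_iff.2 (Finset.ne_of_mem_erase ha)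
    rw [Finset.sum_eq_single (x / Algebra.norm K a)]
    · rw [if_pos (div_mul_cancel₀ _ ha)]
    · intro y _ hy
      rw [if_neg]
      rintro rfl
      exact hy (mul_div_cancel_right₀ _ ha).symm
    · simp
  -- The term a = 0 contributes nothing, as y * N(0) = 0 is not x.
  · refine Finset.sum_eq_zero fun y _ => if_neg ?_
    rw [Algebra.norm_zero, mul_zero]
    exact hx.symm

/-- The common size of the fibres of the norm on the units of an extension. -/
noncomputable def normFiberCard (K A : Type*) [Fintype K] [Fintype A] : ℂ :=
  ((Fintype.card A : ℂ) - 1) / ((Fintype.card K : ℂ) - 1)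

theorem card_units_cast {E : Type*} [Field E] [Fintype E] [DecidableEq E] :
    (Fintype.card Eˣ : ℂ) = (Fintype.card E : ℂ) - 1 := by
  rw [Fintype.card_units, Nat.cast_sub Fintype.card_pos, Nat.cast_one]

/-- The norm is surjective on units of finite fields, so its fibres there all have the same size;
the case f = 1 computes that size. -/
theorem sum_units_norm (f : Kˣ → ℂ) :
    ∑ a : Aˣ, f (Units.map (Algebra.norm K) a) = normFiberCard K A * ∑ x : Kˣ, f x := by
  classical
  have hsurj := FiniteField.unitsMap_norm_surjective K A
  set N : Aˣ →* Kˣ := Units.map (Algebra.norm K)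
  have h1 : ∀ g : Kˣ → ℂ, ∑ a : Aˣ, g (N a) =
      (Finset.card {a | N a = 1} : ℂ) * ∑ x : Kˣ, g x := by
    intro g
    rw [← Finset.sum_fiberwise (g := N), Finset.mul_sum]
    refine Finset.sum_congr rfl fun x _ => ?_
    rw [Finset.sum_congr rfl (g := fun _ => g x)
      (fun a ha => by rw [(Finset.mem_filter.1 ha).2]), Finset.sum_const, nsmul_eq_mul,
      MonoidHom.card_fiber_eq_of_mem_range N (hsurj x) (hsurj 1)]
  have h2 := h1 fun _ => 1
  simp only [Finset.sum_const, Finset.card_univ, nsmul_eq_mul, mul_one] at h2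
  rw [h1, normFiberCard, ← card_units_cast (E := A), ← card_units_cast (E := K), h2,
    mul_div_cancel_right₀]
  rw [card_units_cast]
  exact card_sub_one_ne_zero

/-- The sum of `ψ(Tr(αa) + Tr(βb))` over all pairs with `a ≠ 0` and `N(b) = c N(a)`. -/
noncomputable def normPairSum (ψ : AddChar K ℂ) (c : K) (α : A) (β : B) : ℂ :=
    ∑ a : Aˣ, ∑ b : B, if Algebra.norm K b = c * Algebra.norm K (a : A) then
    ψ (Algebra.trace K A (α * a)) * ψ (Algebra.trace K B (β * b)) else 0

theorem normPairSum_zero (hψ : ψ ≠ 1) (α : A) (β : B) :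
    normPairSum ψ 0 α β = (if α = 0 then (Fintype.card A : ℂ) else 0) - 1 := by
  rw [← sum_units_addChar_trace hψ]
  refine Finset.sum_congr rfl fun a _ => ?_
  simp [Algebra.norm_eq_zero_iff]

theorem sum_units_addChar_mul (hψ : ψ ≠ 1) {d : K} (hd : d ≠ 0) :
    ∑ x : Kˣ, ψ (d * x) = -1 := by
  rw [sum_units_eq (fun x : K => ψ (d * x)), mul_zero, AddChar.map_zero_eq_one,
    Fintype.sum_equiv (Equiv.mulLeft₀ d hd) (fun x => ψ (d * x)) ψ fun _ => rfl,
    AddChar.sum_eq_zero_of_ne_one hψ, zero_sub]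

/-- Rescaling a and b absorbs α and β into the constant c. After the fibre sum over b is replaced by
a sum over a', the substitution a = u a' leaves an orthogonality sum over a' that singles out u =
-1; this is the origin of the factor N(-1). -/
theorem normPairSum_of_ne_zero (hψ : ψ ≠ 1)
    (h : Module.finrank K B = Module.finrank K A + 1) {c : K} (hc : c ≠ 0) {α : A} {β : B}
    (hα : α ≠ 0) (hβ : β ≠ 0) :
    normPairSum ψ c α β =
      - (Fintype.card A : ℂ) *
        ψ (c * (Algebra.norm K β / Algebra.norm K α * Algebra.norm K (-1 : A))) -
        normFiberCard K A := by
  have hNα : Algebra.norm K α ≠ 0 := Algebra.norm_ne_zero_iff.2 hα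
  have hNβ : Algebra.norm K β ≠ 0 := Algebra.norm_ne_zero_iff.2 hβ
  have hN : ∀ a : Aˣ, Algebra.norm K (a : A) ≠ 0 := fun a => Algebra.norm_ne_zero_iff.2 a.ne_zero
  set c' := c * (Algebra.norm K β / Algebra.norm K α) with hc'
  have hc'0 : c' ≠ 0 := mul_ne_zero hc (div_ne_zero hNβ hNα)
  have h1 : normPairSum ψ c α β = ∑ a : Aˣ, ψ (Algebra.trace K A a) *
      ∑ b : B, if Algebra.norm K b = c' * Algebra.norm K (a : A) then
        ψ (Algebra.trace K B b) else 0 := by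
    refine Fintype.sum_equiv (Equiv.mulLeft (Units.mk0 α hα)) _ _ fun a => ?_
    rw [Finset.mul_sum]
    refine Fintype.sum_equiv (Equiv.mulLeft₀ β hβ) _ _ fun b => ?_
    simp only [Equiv.coe_mulLeft, Equiv.mulLeft₀_apply, Units.val_mul, Units.val_mk0, map_mul,
      mul_ite, mul_zero]
    refine if_congr ?_ rfl rfl
    rw [hc', mul_assoc, ← mul_assoc (_ / _), div_mul_cancel₀ _ hNα, mul_left_comm]
    exact (mul_right_inj' hNβ).symm
  have h2 : normPairSum ψ c α β = - ∑ u : Aˣ, ψ (c' * Algebra.norm K (u : A)) *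
      ∑ a : Aˣ, ψ (Algebra.trace K A ((1 + u) * a)) := by
    have : ∀ a : Aˣ, (ψ (Algebra.trace K A a) *
      ∑ b : B, if Algebra.norm K b = c' * Algebra.norm K (a : A) then
        ψ (Algebra.trace K B b) else 0) =
        - ∑ a' : Aˣ, ψ (c' * Algebra.norm K (a : A) / Algebra.norm K (a' : A)) *
          (ψ (Algebra.trace K A a) * ψ (Algebra.trace K A a')) := fun a => by
      rw [sum_norm_fiber_addChar_trace hψ h (mul_ne_zero hc'0 (hN a)), mul_neg, Finset.mul_sum]
      congr 1
      exact Finset.sum_congr rfl fun a' _ => by ring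
    rw [h1, Finset.sum_congr rfl fun a _ => this a, Finset.sum_neg_distrib, Finset.sum_comm]
    congr 1
    simp only [Finset.mul_sum]
    conv_rhs => rw [Finset.sum_comm]
    refine Finset.sum_congr rfl fun a' _ => ?_
    refine (Fintype.sum_equiv (Equiv.mulRight a') _ _ fun u => ?_).symm
    rw [Equiv.coe_mulRight, Units.val_mul, map_mul (Algebra.norm K), ← mul_assoc c',
      mul_div_cancel_right₀ _ (hN a'), add_mul, one_mul, map_add, AddChar.map_add_eq_mul,
      mul_comm (ψ (Algebra.trace K A a'))]
  -- This sum collects the -1 that every u gets because a' runs over units only.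
  have h3 : ∑ u : Aˣ, ψ (c' * Algebra.norm K (u : A)) = - normFiberCard K A := by
    refine (sum_units_norm (A := A) fun x : Kˣ => ψ (c' * x)).trans ?_
    rw [sum_units_addChar_mul hψ hc'0, mul_neg_one]
  have h4 : ∀ u : Aˣ, (1 + (u : A) = 0) ↔ u = -1 := fun u => by
    rw [add_comm, add_eq_zero_iff_eq_neg, Units.ext_iff, Units.val_neg, Units.val_one]
  rw [h2]
  simp only [sum_units_addChar_trace hψ, h4, mul_sub, mul_one, mul_ite, mul_zero,
    Finset.sum_sub_distrib, Finset.sum_ite_eq', Finset.mem_univ, if_true, h3]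
  rw [Units.val_neg, Units.val_one, hc', mul_assoc]
  ring

/-- With α = 0 only N(a) matters; every nonzero b then occurs once for each a of norm N(b)/c, and
the sum over nonzero b is -1. -/
theorem normPairSum_zero_left (hψ : ψ ≠ 1) {c : K} (hc : c ≠ 0) {β : B} (hβ : β ≠ 0) :
    normPairSum ψ c (0 : A) β = - normFiberCard K A := by
  have h1 : normPairSum ψ c (0 : A) β = normFiberCard K A * ∑ x : Kˣ, ∑ b : B,
      if Algebra.norm K b = c * x then ψ (Algebra.trace K B (β * b)) else 0 := by
    rw [← sum_units_norm (A := A) fun x : Kˣ => ∑ b : B,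
      if Algebra.norm K b = c * x then ψ (Algebra.trace K B (β * b)) else 0]
    refine Finset.sum_congr rfl fun a _ => Finset.sum_congr rfl fun b _ => ?_
    rw [zero_mul, map_zero, AddChar.map_zero_eq_one, one_mul]
    rfl
  have h2 : ∀ b : B, (∑ x : Kˣ,
      if Algebra.norm K b = c * x then ψ (Algebra.trace K B (β * b)) else 0) =
      if b = 0 then 0 else ψ (Algebra.trace K B (β * b)) := fun b => by
    split_ifs with hb
    · refine Finset.sum_eq_zero fun x _ => if_neg ?_
      rw [hb, Algebra.norm_zero]
      exact (mul_ne_zero hc x.ne_zero).symm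
    · have hN : Algebra.norm K b ≠ 0 := Algebra.norm_ne_zero_iff.2 hb
      rw [Finset.sum_eq_single (Units.mk0 _ (div_ne_zero hN hc))]
      · rw [if_pos]
        rw [Units.val_mk0, mul_div_cancel₀ _ hc]
      · intro x _ hx
        rw [if_neg]
        intro h
        refine hx (Units.ext ?_)
        rw [Units.val_mk0, h, mul_div_cancel_left₀ _ hc]
      · simp
  have h3 := sum_units_addChar_trace (K := K) hψ β
  rw [if_neg hβ, zero_sub, sum_units_eq (fun b : B => ψ (Algebra.trace K B (β * b))),
    ← Finset.sum_erase_eq_sub (Finset.mem_univ _)] at h3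
  rw [h1, Finset.sum_comm, Finset.sum_congr rfl fun b _ => h2 b, Finset.sum_ite,
    Finset.sum_const_zero, zero_add, Finset.filter_ne', h3, mul_neg_one]

theorem sum_norm_eq_one {y : K} (hy : y ≠ 0) :
    ∑ b : B, (if Algebra.norm K b = y then (1 : ℂ) else 0) = normFiberCard K B := by
  have h1 := sum_units_eq (fun b : B => if Algebra.norm K b = y then (1 : ℂ) else 0)
  rw [Algebra.norm_zero, if_neg hy.symm, sub_zero] at h1
  have h2 := sum_units_norm (A := B) fun x : Kˣ => if (x : K) = y then (1 : ℂ) else 0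
  have h3 : ∑ x : Kˣ, (if (x : K) = y then (1 : ℂ) else 0) = 1 := by
    rw [Finset.sum_eq_single (Units.mk0 y hy)]
    · simp
    · intro x _ hx
      exact if_neg fun h => hx (Units.ext h)
    · simp
  rw [h3, mul_one] at h2
  rw [← h1, ← h2]
  rfl

theorem normPairSum_zero_right (hψ : ψ ≠ 1) {c : K} (hc : c ≠ 0) (α : A) :
    normPairSum ψ c α (0 : B) =
      ((if α = 0 then (Fintype.card A : ℂ) else 0) - 1) * normFiberCard K B := by
  rw [← sum_units_addChar_trace hψ, Finset.sum_mul]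
  refine Finset.sum_congr rfl fun a _ => ?_
  rw [← sum_norm_eq_one (mul_ne_zero hc (Algebra.norm_ne_zero_iff.2 a.ne_zero)), Finset.mul_sum]
  refine Finset.sum_congr rfl fun b _ => ?_
  simp

end NormSums

/-! ### From scaling-stable sets to codes, and weights as character sums. -/

section CodeOfSet
set_option linter.unusedSectionVars false
open scoped LinearAlgebra.Projectivization

variable {F : Type*} [Field F] [Fintype F] [DecidableEq F]
  {V : Type*} [AddCommGroup V] [Module F V]

open scoped Classical in
/-- A set of nonzero vectors that is stable under scaling is a union of punctured lines. -/
theorem card_eq_mul_card_rep_mem [Fintype (ℙ F V)] (T : Finset V) (h0 : (0 : V) ∉ T)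
    (hT : ∀ c : Fˣ, ∀ v ∈ T, c • v ∈ T) :
    T.card = (Fintype.card F - 1) * Finset.card {p : ℙ F V | p.rep ∈ T} := by
  rw [← Fintype.card_units, ← Finset.card_univ, ← Finset.card_product]
  symm
  refine Finset.card_bij (fun x _ => x.1 • x.2.rep) ?_ ?_ ?_
  · rintro ⟨c, p⟩ h
    simp only [Finset.mem_product, Finset.mem_filter] at h
    exact hT c _ h.2.2
  · rintro ⟨c, p⟩ h ⟨c', p'⟩ h' heq
    have hp : p = p' := by
      rw [← p.mk_rep, ← p'.mk_rep, Projectivization.mk_eq_mk_iff]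
      refine ⟨c⁻¹ * c', ?_⟩
      rw [mul_smul, ← heq, inv_smul_smul]
    subst hp
    simp only [Prod.mk.injEq, and_true]
    exact Units.ext (smul_left_injective F p.rep_nonzero heq)
  · intro v hv
    have hv0 : v ≠ 0 := fun h => h0 (h ▸ hv)
    obtain ⟨a, ha⟩ := Projectivization.exists_smul_eq_mk_rep F v hv0
    refine ⟨(a⁻¹, Projectivization.mk F v hv0), ?_, ?_⟩
    · simp only [Finset.mem_product, Finset.mem_filter, Finset.mem_univ, true_and]
      exact ha ▸ hT a v hv
    · simp only [← ha, inv_smul_smul]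

/-- The linear map whose range is `codeOf y`. -/
def codeMap {n k : ℕ} (y : Fin n → (Fin k → F)) : (Fin k → F) →ₗ[F] (Fin n → F) where
  toFun x i := x ⬝ᵥ y i
  map_add' x z := by funext i; simp [add_dotProduct]
  map_smul' a x := by funext i; simp [smul_dotProduct]

theorem codeOf_eq_range {n k : ℕ} (y : Fin n → (Fin k → F)) :
    codeOf y = LinearMap.range (codeMap y) := by
  ext c
  exact ⟨fun ⟨x, hx⟩ => ⟨x, hx.symm⟩, fun ⟨x, hx⟩ => ⟨x, hx.symm⟩⟩

/-- A scaling-stable set of nonzero vectors that every nonzero functional meets in one of two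
numbers of vectors off its kernel yields a projective two-weight code. -/
theorem exists_isProjectiveTwoWeightCode [Module.Finite F V] {k : ℕ}
    (hk : Module.finrank F V = k) (S : Finset V) (h0 : (0 : V) ∉ S)
    (hS : ∀ c : Fˣ, ∀ v ∈ S, c • v ∈ S) {w₁ w₂ : ℕ} (hw : w₁ ≠ w₂) (hw₁ : w₁ ≠ 0)
    (hw₂ : w₂ ≠ 0)
    (hf : ∀ f : V →ₗ[F] F, f ≠ 0 → Finset.card {s ∈ S | f s ≠ 0} = (Fintype.card F - 1) * w₁ ∨
      Finset.card {s ∈ S | f s ≠ 0} = (Fintype.card F - 1) * w₂)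
    (hf₁ : ∃ f : V →ₗ[F] F, Finset.card {s ∈ S | f s ≠ 0} = (Fintype.card F - 1) * w₁)
    (hf₂ : ∃ f : V →ₗ[F] F, Finset.card {s ∈ S | f s ≠ 0} = (Fintype.card F - 1) * w₂) :
    ∃ n : ℕ, (Fintype.card F - 1) * n = S.card ∧
      ∃ C : Submodule F (Fin n → F), IsProjectiveTwoWeightCode k C w₁ w₂ := by
  classical
  have : Finite V := Module.finite_of_finite F
  have : Fintype (ℙ F V) := Fintype.ofFinite _
  have hq : 0 < Fintype.card F - 1 := Nat.sub_pos_of_lt Fintype.one_lt_card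
  let P : Finset (ℙ F V) := {p | p.rep ∈ S}
  let b : Module.Basis (Fin k) F V := Module.finBasisOfFinrankEq F V hk
  let e : Fin P.card ≃ P := P.equivFin.symm
  let y : Fin P.card → (Fin k → F) := fun i => b.equivFun (e i).1.rep
  have hfun : ∀ (f : V →ₗ[F] F) (v : V), (fun j => f (b j)) ⬝ᵥ b.equivFun v = f v := by
    intro f v
    conv_rhs => rw [← b.sum_equivFun v, map_sum]
    refine Finset.sum_congr rfl fun j _ => ?_
    rw [map_smul, smul_eq_mul, mul_comm]
  have hweight : ∀ f : V →ₗ[F] F, (Fintype.card F - 1) *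
      hammingNorm (codeMap y fun j => f (b j)) = Finset.card {s ∈ S | f s ≠ 0} := by
    intro f
    rw [card_eq_mul_card_rep_mem (F := F) {s ∈ S | f s ≠ 0} (by simp [h0])]
    · congr 1
      refine Finset.card_bij (fun i _ => (e i).1) ?_ ?_ ?_
      · intro i hi
        have hP := (Finset.mem_filter.1 (e i).2).2
        have hi : (fun j => f (b j)) ⬝ᵥ y i ≠ 0 := (Finset.mem_filter.1 hi).2
        rw [hfun] at hi
        exact Finset.mem_filter.2 ⟨Finset.mem_univ _, Finset.mem_filter.2 ⟨hP, hi⟩⟩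
      · intro i _ j _ h
        exact e.injective (Subtype.ext h)
      · intro p hp
        have hp := Finset.mem_filter.1 (Finset.mem_filter.1 hp).2
        have hpP : p ∈ P := Finset.mem_filter.2 ⟨Finset.mem_univ _, hp.1⟩
        refine ⟨e.symm ⟨p, hpP⟩, Finset.mem_filter.2 ⟨Finset.mem_univ _, ?_⟩, by simp⟩
        change (fun j => f (b j)) ⬝ᵥ b.equivFun (e (e.symm ⟨p, hpP⟩)).1.rep ≠ 0
        rw [hfun, Equiv.apply_symm_apply]
        exact hp.2
    · intro c v hv
      rw [Finset.mem_filter] at hv ⊢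
      refine ⟨hS c v hv.1, ?_⟩
      rw [Units.smul_def, map_smul]
      exact smul_ne_zero c.ne_zero hv.2
  have hfx : ∀ x : Fin k → F, (fun j => b.constr F x (b j)) = x := fun x => by
    funext j
    rw [b.constr_basis]
  have hx : ∀ x : Fin k → F, x ≠ 0 → hammingNorm (codeMap y x) = w₁ ∨
      hammingNorm (codeMap y x) = w₂ := by
    intro x hx
    have hne : b.constr F x ≠ (0 : V →ₗ[F] F) := fun h => hx (by rw [← hfx x, h]; rfl)
    have h := hweight (b.constr F x)
    rw [hfx] at h
    rcases hf _ hne with h' | h'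
    · exact Or.inl (Nat.eq_of_mul_eq_mul_left hq (h.trans h'))
    · exact Or.inr (Nat.eq_of_mul_eq_mul_left hq (h.trans h'))
  refine ⟨P.card, (card_eq_mul_card_rep_mem S h0 hS).symm, codeOf y, ?_, ⟨y, rfl, ?_⟩, hw, ?_⟩
  -- Both weights are nonzero, so no nonzero message is sent to the zero word and the dimension is
  -- k.
  · rw [codeOf_eq_range, LinearMap.finrank_range_of_inj, Module.finrank_fin_fun]
    rw [← LinearMap.ker_eq_bot, LinearMap.ker_eq_bot']
    intro x h
    by_contra hx0
    rcases hx x hx0 with h' | h' <;> rw [h, hammingNorm_zero] at h'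
    · exact hw₁ h'.symm
    · exact hw₂ h'.symm
  · intro i j hij
    have hne : (e i).1 ≠ (e j).1 := fun h => hij (e.injective (Subtype.ext h))
    have hind := Projectivization.independent_iff.1
      ((Projectivization.independent_pair_iff_ne _ _).2 hne)
    have := hind.map' b.equivFun.toLinearMap b.equivFun.ker
    convert! this using 1
    funext l
    fin_cases l <;> rfl
  · ext w
    simp only [Set.mem_ofPred_eq, Set.mem_insert_iff, Set.mem_singleton_iff]
    constructor
    · rintro ⟨hw0, c, ⟨x, rfl⟩, rfl⟩
      refine hx x ?_
      rintro rfl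
      refine hw0 ?_
      rw [hammingNorm_eq_zero]
      funext i
      simp
    · have key : ∀ w, w ≠ 0 →
          (∃ f : V →ₗ[F] F, Finset.card {s ∈ S | f s ≠ 0} = (Fintype.card F - 1) * w) →
          w ≠ 0 ∧ ∃ c ∈ codeOf y, hammingNorm c = w := by
        rintro w hw0 ⟨f, hf⟩
        exact ⟨hw0, _, ⟨_, rfl⟩, Nat.eq_of_mul_eq_mul_left hq ((hweight f).trans hf)⟩
      rintro (rfl | rfl)
      · exact key _ hw₁ hf₁
      · exact key _ hw₂ hf₂

open scoped Classical in
/-- The number of vectors of a scaling-stable set off the kernel of a functional, as a character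
sum. -/
theorem card_mul_card_filter_ne_zero (S : Finset V) (hS : ∀ c : Fˣ, ∀ v ∈ S, c • v ∈ S)
    {ψ : AddChar F ℂ} (hψ : ψ ≠ 1) (f : V →ₗ[F] F) :
    (Fintype.card F : ℂ) * Finset.card {s ∈ S | f s ≠ 0} =
      ((Fintype.card F : ℂ) - 1) * (S.card - ∑ s ∈ S, ψ (f s)) := by
  have h1 : ∀ c : Fˣ, ∑ s ∈ S, ψ (c * f s) = ∑ s ∈ S, ψ (f s) := by
    intro c
    refine Finset.sum_nbij' (fun s => c • s) (fun s => c⁻¹ • s) (hS c) (hS c⁻¹) ?_ ?_ ?_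
    · intro s _
      exact inv_smul_smul c s
    · intro s _
      exact smul_inv_smul c s
    · intro s _
      rw [Units.smul_def, map_smul, smul_eq_mul]
  -- The double sum is evaluated twice: S is stable under each c, while for fixed s the sum over c
  -- is q - 1 or -1 according to whether f s vanishes.
  have h2 : ∑ c : Fˣ, ∑ s ∈ S, ψ (c * f s) =
      ((Fintype.card F : ℂ) - 1) * ∑ s ∈ S, ψ (f s) := by
    rw [Finset.sum_congr rfl fun c _ => h1 c, Finset.sum_const, Finset.card_univ, nsmul_eq_mul,
      card_units_cast]
  have h3 : ∀ s : V, ∑ c : Fˣ, ψ (c * f s) =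
      ((Fintype.card F : ℂ) - 1) - Fintype.card F * if f s ≠ 0 then 1 else 0 := by
    intro s
    split_ifs with hs
    · simp only [mul_comm _ (f s)]
      rw [sum_units_addChar_mul hψ hs]
      ring
    · rw [not_not.1 hs]
      simp only [mul_zero, AddChar.map_zero_eq_one, Finset.sum_const, Finset.card_univ,
        nsmul_eq_mul, card_units_cast]
      ring
  rw [Finset.sum_comm, Finset.sum_congr rfl fun s _ => h3 s, Finset.sum_sub_distrib,
    ← Finset.mul_sum, Finset.sum_boole, Finset.sum_const, nsmul_eq_mul] at h2
  linear_combination -h2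

theorem sum_addChar_linearMap [Fintype V] {ψ : AddChar F ℂ} (hψ : ψ ≠ 1) {f : V →ₗ[F] F}
    (hf : f ≠ 0) : ∑ v : V, ψ (f v) = 0 := by
  refine AddChar.sum_eq_zero_of_ne_one (ψ := ψ.compAddMonoidHom f.toAddMonoidHom) ?_
  obtain ⟨x, hx⟩ := AddChar.ne_one_iff.1 hψ
  obtain ⟨v, rfl⟩ := LinearMap.surjective hf x
  exact AddChar.ne_one_iff.2 ⟨v, hx⟩

end CodeOfSet

/-! ### The norm cone and its two intersection numbers. -/

section NormCone
set_option linter.unusedSectionVars false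

variable {F : Type*} [Field F] [Fintype F] [DecidableEq F]
  {K : Type*} [Field K] [Fintype K] [DecidableEq K] [Algebra F K]
  {A : Type*} [Field A] [Fintype A] [DecidableEq A] [Algebra K A] [Algebra F A]
  [IsScalarTower F K A]
  {B : Type*} [Field B] [Fintype B] [DecidableEq B] [Algebra K B] [Algebra F B]
  [IsScalarTower F K B]

variable (A B) in
open scoped Classical in
/-- The pairs `(a, b)` with `a ≠ 0` and `N(b) ∈ N(a) U`. -/
noncomputable def normCone (U : Submodule F K) : Finset (A × B) :=
  {p | p.1 ≠ 0 ∧ Algebra.norm K p.2 / Algebra.norm K p.1 ∈ U}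

theorem mem_normCone {U : Submodule F K} {p : A × B} :
    p ∈ normCone A B U ↔ p.1 ≠ 0 ∧ Algebra.norm K p.2 / Algebra.norm K p.1 ∈ U := by
  simp [normCone]

theorem norm_smul_of_tower (c : F) (a : A) :
    Algebra.norm K (c • a) = algebraMap F K c ^ Module.finrank K A * Algebra.norm K a := by
  rw [← Algebra.norm_algebraMap, ← map_mul, ← IsScalarTower.algebraMap_apply, Algebra.smul_def]

/-- A scalar c multiplies N(b)/N(a) by c^(ℓ+1)/c^ℓ = c, where ℓ = [A : K]; hence a linear condition
on the quotient is preserved. -/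
theorem smul_mem_normCone (h : Module.finrank K B = Module.finrank K A + 1) (U : Submodule F K)
    (c : Fˣ) (p : A × B) (hp : p ∈ normCone A B U) : c • p ∈ normCone A B U := by
  rw [mem_normCone] at hp ⊢
  refine ⟨smul_ne_zero c.ne_zero hp.1, ?_⟩
  have hc : algebraMap F K c ≠ 0 := by simp
  have hN : Algebra.norm K p.1 ≠ 0 := Algebra.norm_ne_zero_iff.2 hp.1
  have : Algebra.norm K (c • p).2 / Algebra.norm K (c • p).1 =
      (c : F) • (Algebra.norm K p.2 / Algebra.norm K p.1) := by
    rw [Prod.smul_fst, Prod.smul_snd, Units.smul_def, Units.smul_def, norm_smul_of_tower,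
      norm_smul_of_tower, h, Algebra.smul_def]
    field_simp
    ring
  rw [this]
  exact U.smul_mem _ hp.2

theorem exists_eq_trace_mul [FiniteDimensional F A] (f : A →ₗ[F] F) :
    ∃ α : A, ∀ a, f a = Algebra.trace F A (α * a) := by
  obtain ⟨α, hα⟩ := (LinearMap.BilinForm.toDual _ (traceForm_nondegenerate F A)).surjective f
  exact ⟨α, fun a => by rw [← hα]; rfl⟩

theorem exists_eq_trace_add_trace (f : A × B →ₗ[F] F) :
    ∃ (α : A) (β : B), ∀ p, f p = Algebra.trace F A (α * p.1) + Algebra.trace F B (β * p.2) := by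
  obtain ⟨α, hα⟩ := exists_eq_trace_mul (f.comp (LinearMap.inl F A B))
  obtain ⟨β, hβ⟩ := exists_eq_trace_mul (f.comp (LinearMap.inr F A B))
  refine ⟨α, β, fun p => ?_⟩
  rw [← hα, ← hβ, LinearMap.comp_apply, LinearMap.comp_apply, ← map_add]
  simp

/-- The pullback of an additive character along the trace. -/
noncomputable def traceChar (K : Type*) [Field K] [Algebra F K] (ψ : AddChar F ℂ) :
    AddChar K ℂ :=
  ψ.compAddMonoidHom (Algebra.trace F K).toAddMonoidHom

theorem traceChar_apply (ψ : AddChar F ℂ) (x : K) :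
    traceChar K ψ x = ψ (Algebra.trace F K x) := rfl

theorem traceChar_ne_one {ψ : AddChar F ℂ} (hψ : ψ ≠ 1) : traceChar K ψ ≠ 1 := by
  obtain ⟨x, hx⟩ := AddChar.ne_one_iff.1 hψ
  obtain ⟨a, rfl⟩ := Algebra.trace_surjective F K x
  exact AddChar.ne_one_iff.2 ⟨a, hx⟩

open scoped Classical in
-- Each pair of the cone determines c = N(b)/N(a) ∈ U, and transitivity of the trace moves the
-- character from F to K.
theorem sum_normCone (ψ : AddChar F ℂ) (U : Submodule F K) (α : A) (β : B) :
    ∑ p ∈ normCone A B U,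
        ψ (Algebra.trace F A (α * p.1) + Algebra.trace F B (β * p.2)) =
      ∑ c : U, normPairSum (traceChar K ψ) (c : K) α β := by
  have h1 : ∀ p : A × B, ψ (Algebra.trace F A (α * p.1) + Algebra.trace F B (β * p.2)) =
      traceChar K ψ (Algebra.trace K A (α * p.1)) *
        traceChar K ψ (Algebra.trace K B (β * p.2)) := fun p => by
    rw [AddChar.map_add_eq_mul, traceChar_apply, traceChar_apply, Algebra.trace_trace,
      Algebra.trace_trace]
  simp only [h1]
  generalize traceChar K ψ = χ
  rw [normCone, Finset.sum_filter, Fintype.sum_prod_type]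
  have h2 := sum_units_eq (fun a : A => ∑ b : B,
    if a ≠ 0 ∧ Algebra.norm K b / Algebra.norm K a ∈ U then
      χ (Algebra.trace K A (α * a)) * χ (Algebra.trace K B (β * b)) else 0)
  simp only [ne_eq, not_true, false_and, if_false, Finset.sum_const_zero, sub_zero] at h2
  simp only [ne_eq, ← h2, normPairSum]
  conv_rhs => rw [Finset.sum_comm]
  refine Finset.sum_congr rfl fun a _ => ?_
  conv_rhs => rw [Finset.sum_comm]
  refine Finset.sum_congr rfl fun b _ => ?_
  have hN : Algebra.norm K (a : A) ≠ 0 := Algebra.norm_ne_zero_iff.2 a.ne_zero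
  by_cases hU : Algebra.norm K b / Algebra.norm K (a : A) ∈ U
  · rw [if_pos ⟨a.ne_zero, hU⟩, Finset.sum_eq_single ⟨_, hU⟩]
    · rw [if_pos (div_mul_cancel₀ _ hN).symm]
    · intro c _ hc
      rw [if_neg]
      intro h
      exact hc (Subtype.ext (eq_div_of_mul_eq hN h.symm))
    · simp
  · rw [if_neg fun h => hU h.2, Finset.sum_eq_zero]
    intro c _
    rw [if_neg]
    intro h
    rw [h, mul_div_cancel_right₀ _ hN] at hU
    exact hU c.2

open scoped Classical in
-- The closed forms of `normPairSum` hold for c ≠ 0 only; this corrects the term c = 0.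
theorem sum_submodule_eq (U : Submodule F K) (g h : K → ℂ) (hgh : ∀ c, c ≠ 0 → g c = h c) :
    ∑ c : U, g c = ∑ c : U, h c + (g 0 - h 0) := by
  rw [← sub_eq_iff_eq_add', ← Finset.sum_sub_distrib, Finset.sum_eq_single 0]
  · rfl
  · intro c _ hc
    rw [hgh c (by simpa using hc), sub_self]
  · simp

open scoped Classical in
theorem sum_submodule_addChar (U : Submodule F K) (χ : AddChar K ℂ) (d : K) :
    ∑ c : U, χ (c * d) = Fintype.card U ∨ ∑ c : U, χ (c * d) = 0 := by
  have := AddChar.sum_eq_ite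
    (χ.compAddMonoidHom ((AddMonoidHom.mulRight d).comp U.toAddSubgroup.subtype))
  simp only [AddChar.compAddMonoidHom_apply] at this
  by_cases h : χ.compAddMonoidHom ((AddMonoidHom.mulRight d).comp U.toAddSubgroup.subtype) = 0
  · rw [if_pos h] at this
    exact Or.inl this
  · rw [if_neg h] at this
    exact Or.inr this

open scoped Classical in
theorem sum_normPairSum_zero_left {χ : AddChar K ℂ} (hχ : χ ≠ 1) (U : Submodule F K) {β : B}
    (hβ : β ≠ 0) :
    ∑ c : U, normPairSum χ (c : K) (0 : A) β =
      Fintype.card A - 1 - ((Fintype.card U : ℂ) - 1) * normFiberCard K A := by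
  rw [sum_submodule_eq U _ (fun _ => - normFiberCard K A)
    fun c hc => normPairSum_zero_left hχ hc hβ, normPairSum_zero hχ, if_pos rfl,
    Finset.sum_const, Finset.card_univ, nsmul_eq_mul]
  ring

open scoped Classical in
theorem sum_normPairSum_zero_right {χ : AddChar K ℂ} (hχ : χ ≠ 1) (U : Submodule F K) (α : A) :
    ∑ c : U, normPairSum χ (c : K) α (0 : B) =
      ((if α = 0 then (Fintype.card A : ℂ) else 0) - 1) *
        (1 + ((Fintype.card U : ℂ) - 1) * normFiberCard K B) := by
  rw [sum_submodule_eq U _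
    (fun _ => ((if α = 0 then (Fintype.card A : ℂ) else 0) - 1) * normFiberCard K B)
    fun c hc => normPairSum_zero_right hχ hc α, normPairSum_zero hχ,
    Finset.sum_const, Finset.card_univ, nsmul_eq_mul]
  ring

open scoped Classical in
-- The two values come from orthogonality on the additive group U: the character c ↦ χ(cδ) is either
-- trivial on U or sums to zero.
theorem sum_normPairSum_of_ne_zero {χ : AddChar K ℂ} (hχ : χ ≠ 1)
    (h : Module.finrank K B = Module.finrank K A + 1) (U : Submodule F K) {α : A} {β : B}
    (hα : α ≠ 0) (hβ : β ≠ 0) :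
    ∑ c : U, normPairSum χ (c : K) α β =
        Fintype.card A - 1 - ((Fintype.card U : ℂ) - 1) * normFiberCard K A ∨
      ∑ c : U, normPairSum χ (c : K) α β =
        Fintype.card A - 1 - ((Fintype.card U : ℂ) - 1) * normFiberCard K A -
          Fintype.card A * Fintype.card U := by
  rw [sum_submodule_eq U _ _ fun c hc => normPairSum_of_ne_zero hχ h hc hα hβ,
    normPairSum_zero hχ, if_neg hα, zero_mul, AddChar.map_zero_eq_one,
    Finset.sum_sub_distrib, ← Finset.mul_sum, Finset.sum_const, Finset.card_univ, nsmul_eq_mul]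
  rcases sum_submodule_addChar U χ
    (Algebra.norm K β / Algebra.norm K α * Algebra.norm K (-1 : A)) with h | h
  · right
    rw [h]
    ring
  · left
    rw [h]
    ring

theorem card_eq_card_mul_card (h : Module.finrank K B = Module.finrank K A + 1) :
    Fintype.card B = Fintype.card A * Fintype.card K := by
  rw [Module.card_eq_pow_finrank (K := K) (V := B), Module.card_eq_pow_finrank (K := K) (V := A),
    h, pow_succ]

theorem normFiberCard_mul : normFiberCard K A * ((Fintype.card K : ℂ) - 1) =
    (Fintype.card A : ℂ) - 1 :=
  div_mul_cancel₀ _ card_sub_one_ne_zero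

theorem normFiberCard_succ (h : Module.finrank K B = Module.finrank K A + 1) :
    normFiberCard K B = normFiberCard K A + Fintype.card A := by
  refine mul_right_cancel₀ (card_sub_one_ne_zero (K := K)) ?_
  rw [add_mul, normFiberCard_mul, normFiberCard_mul, card_eq_card_mul_card h]
  push_cast
  ring

theorem primitiveChar_to_Complex_ne_one (F : Type*) [Field F] [Finite F] :
    AddChar.FiniteField.primitiveChar_to_Complex F ≠ 1 := by
  have h := AddChar.FiniteField.primitiveChar_to_Complex_isPrimitive F one_ne_zero
  rwa [AddChar.mulShift_one] at h

open scoped Classical in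
theorem card_normCone (U : Submodule F K) :
    ((normCone A B U).card : ℂ) =
      ((Fintype.card A : ℂ) - 1) * (1 + ((Fintype.card U : ℂ) - 1) * normFiberCard K B) := by
  have hψ : traceChar K (AddChar.FiniteField.primitiveChar_to_Complex F) ≠ 1 :=
    traceChar_ne_one (primitiveChar_to_Complex_ne_one F)
  have h := sum_normCone (AddChar.FiniteField.primitiveChar_to_Complex F) U (0 : A) (0 : B)
  rw [sum_normPairSum_zero_right hψ, if_pos rfl] at h
  simpa using h

open scoped Classical in
/-- The two numbers of elements of the norm cone off the kernel of a functional. -/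
theorem card_normCone_filter (h : Module.finrank K B = Module.finrank K A + 1)
    (U : Submodule F K) :
    (∀ f : A × B →ₗ[F] F, f ≠ 0 →
      (Fintype.card F : ℂ) * Finset.card {s ∈ normCone A B U | f s ≠ 0} =
        ((Fintype.card F : ℂ) - 1) * (((Fintype.card U : ℂ) - 1) * normFiberCard K A *
          Fintype.card B + Fintype.card A * Fintype.card U) ∨
      (Fintype.card F : ℂ) * Finset.card {s ∈ normCone A B U | f s ≠ 0} =
        ((Fintype.card F : ℂ) - 1) * (((Fintype.card U : ℂ) - 1) * normFiberCard K A *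
          Fintype.card B)) ∧
    (∃ f : A × B →ₗ[F] F, f ≠ 0 ∧
      (Fintype.card F : ℂ) * Finset.card {s ∈ normCone A B U | f s ≠ 0} =
        ((Fintype.card F : ℂ) - 1) * (((Fintype.card U : ℂ) - 1) * normFiberCard K A *
          Fintype.card B + Fintype.card A * Fintype.card U)) ∧
    (∃ f : A × B →ₗ[F] F, f ≠ 0 ∧
      (Fintype.card F : ℂ) * Finset.card {s ∈ normCone A B U | f s ≠ 0} =
        ((Fintype.card F : ℂ) - 1) * (((Fintype.card U : ℂ) - 1) * normFiberCard K A *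
          Fintype.card B)) := by
  set ψ := AddChar.FiniteField.primitiveChar_to_Complex F
  have hψ : ψ ≠ 1 := primitiveChar_to_Complex_ne_one F
  have hχ : traceChar K ψ ≠ 1 := traceChar_ne_one hψ
  have hcount : ∀ f : A × B →ₗ[F] F, ∀ (α : A) (β : B),
      (∀ p, f p = Algebra.trace F A (α * p.1) + Algebra.trace F B (β * p.2)) →
      (Fintype.card F : ℂ) * Finset.card {s ∈ normCone A B U | f s ≠ 0} =
        ((Fintype.card F : ℂ) - 1) * ((normCone A B U).card -
          ∑ c : U, normPairSum (traceChar K ψ) (c : K) α β) := by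
    intro f α β hf
    rw [← sum_normCone, card_mul_card_filter_ne_zero _ (smul_mem_normCone h U) hψ]
    simp only [hf]
  have hA := normFiberCard_mul (K := K) (A := A)
  have hB := normFiberCard_mul (K := K) (A := B)
  have hAB := normFiberCard_succ h
  have hcard : (Fintype.card B : ℂ) = Fintype.card A * Fintype.card K := by
    exact_mod_cast card_eq_card_mul_card h
  -- Both (|A| - 1) κ_B and κ_A (|B| - 1) equal κ_A κ_B (|K| - 1), where κ denotes `normFiberCard`.
  have hE₂ : ((normCone A B U).card : ℂ) - (Fintype.card A - 1 -
      ((Fintype.card U : ℂ) - 1) * normFiberCard K A) =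
      ((Fintype.card U : ℂ) - 1) * normFiberCard K A * Fintype.card B := by
    rw [card_normCone]
    linear_combination ((Fintype.card U : ℂ) - 1) * (-normFiberCard K B * hA +
      normFiberCard K A * hB)
  have hright : ∀ α : A, α ≠ 0 → ((normCone A B U).card : ℂ) -
      ∑ c : U, normPairSum (traceChar K ψ) (c : K) α (0 : B) =
      ((Fintype.card U : ℂ) - 1) * normFiberCard K A *
          Fintype.card B + Fintype.card A * Fintype.card U := by
    intro α hα
    -- The identity κ_B = κ_A + |A| makes the case β = 0 agree with one of the two generic values.
    rw [sum_normPairSum_zero_right hχ, if_neg hα, ← hE₂, hAB]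
    ring
  have hleft : ∀ β : B, β ≠ 0 → ((normCone A B U).card : ℂ) -
      ∑ c : U, normPairSum (traceChar K ψ) (c : K) (0 : A) β =
      ((Fintype.card U : ℂ) - 1) * normFiberCard K A * Fintype.card B := by
    intro β hβ
    rw [sum_normPairSum_zero_left hχ U hβ, hE₂]
  refine ⟨fun f hf => ?_, ?_, ?_⟩
  · obtain ⟨α, β, hαβ⟩ := exists_eq_trace_add_trace f
    rw [hcount f α β hαβ]
    by_cases hβ : β = 0
    · subst hβ
      have hα : α ≠ 0 := by
        rintro rfl
        exact hf (LinearMap.ext fun p => by simp [hαβ])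
      exact Or.inl (by rw [hright α hα])
    · by_cases hα : α = 0
      · subst hα
        exact Or.inr (by rw [hleft β hβ])
      · rcases sum_normPairSum_of_ne_zero hχ h U hα hβ with h' | h'
        · right
          rw [h', hE₂]
        · left
          rw [h', ← hE₂]
          ring
  -- The traces of the two coordinates already attain both values, one each.
  · obtain ⟨a, ha⟩ := Algebra.trace_surjective F A 1
    let f : A × B →ₗ[F] F := (Algebra.trace F A).comp (LinearMap.fst F A B)
    refine ⟨f, fun h0 => ?_, ?_⟩
    · have : f (a, 0) = 1 := ha
      rw [h0] at this
      exact zero_ne_one this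
    · rw [hcount f 1 0 fun p => by simp [f], hright 1 one_ne_zero]
  · obtain ⟨b, hb⟩ := Algebra.trace_surjective F B 1
    let f : A × B →ₗ[F] F := (Algebra.trace F B).comp (LinearMap.snd F A B)
    refine ⟨f, fun h0 => ?_, ?_⟩
    · have : f (0, b) = 1 := hb
      rw [h0] at this
      exact zero_ne_one this
    · rw [hcount f 0 1 fun p => by simp [f], hleft 1 one_ne_zero]

end NormCone

/-! ### Two-weight sets, complements and the construction over finite fields. -/

section TwoWeightSets
set_option linter.unusedSectionVars false

variable {F : Type*} [Field F] [Fintype F] [DecidableEq F]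
  {V : Type*} [AddCommGroup V] [Module F V]

/-- A scaling-stable set of nonzero vectors whose numbers of elements off the kernels of nonzero
functionals are exactly `(q - 1) w₁` and `(q - 1) w₂`. -/
def IsTwoWeightSet (F : Type*) [Field F] [Fintype F] [DecidableEq F]
    {V : Type*} [AddCommGroup V] [Module F V] (S : Finset V) (w₁ w₂ : ℕ) : Prop :=
  (0 : V) ∉ S ∧ (∀ c : Fˣ, ∀ v ∈ S, c • v ∈ S) ∧
  (∀ f : V →ₗ[F] F, f ≠ 0 → Finset.card {s ∈ S | f s ≠ 0} = (Fintype.card F - 1) * w₁ ∨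
      Finset.card {s ∈ S | f s ≠ 0} = (Fintype.card F - 1) * w₂) ∧
  (∃ f : V →ₗ[F] F, f ≠ 0 ∧ Finset.card {s ∈ S | f s ≠ 0} = (Fintype.card F - 1) * w₁) ∧
  (∃ f : V →ₗ[F] F, f ≠ 0 ∧ Finset.card {s ∈ S | f s ≠ 0} = (Fintype.card F - 1) * w₂)

theorem card_filter_univ_ne_zero [Fintype V] {k : ℕ} (hk : Module.finrank F V = k + 1)
    {f : V →ₗ[F] F} (hf : f ≠ 0) :
    Finset.card {v : V | f v ≠ 0} = (Fintype.card F - 1) * Fintype.card F ^ k := by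
  have hψ := primitiveChar_to_Complex_ne_one F
  have h := card_mul_card_filter_ne_zero (Finset.univ : Finset V)
    (fun _ _ _ => Finset.mem_univ _) hψ f
  rw [sum_addChar_linearMap hψ hf, sub_zero, Finset.card_univ,
    Module.card_eq_pow_finrank (K := F) (V := V), hk] at h
  have hq : (Fintype.card F : ℂ) ≠ 0 := by simp
  have hq1 : 1 ≤ Fintype.card F := Fintype.card_pos
  refine Nat.cast_injective (R := ℂ) (mul_left_cancel₀ hq ?_)
  convert! h using 1
  push_cast [Nat.cast_sub hq1]
  ring

/-- The complement of a two-weight set is a two-weight set. -/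
theorem IsTwoWeightSet.exists_compl [Module.Finite F V] {k : ℕ}
    (hk : Module.finrank F V = k + 1) {S : Finset V} {w₁ w₂ w₁' w₂' : ℕ}
    (hS : IsTwoWeightSet F S w₁ w₂) (h₁ : w₁ + w₁' = Fintype.card F ^ k)
    (h₂ : w₂ + w₂' = Fintype.card F ^ k) :
    ∃ T : Finset V, IsTwoWeightSet F T w₁' w₂' ∧
      T.card + S.card + 1 = Fintype.card F ^ (k + 1) := by
  classical
  have : Finite V := Module.finite_of_finite F
  have : Fintype V := Fintype.ofFinite V
  obtain ⟨h0, hsmul, hf, ⟨f₁, hf₁0, hf₁⟩, ⟨f₂, hf₂0, hf₂⟩⟩ := hS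
  have hcount : ∀ f : V →ₗ[F] F, f ≠ 0 →
      Finset.card {s ∈ ({v | v ≠ 0 ∧ v ∉ S} : Finset V) | f s ≠ 0} +
        Finset.card {s ∈ S | f s ≠ 0} = (Fintype.card F - 1) * Fintype.card F ^ k := by
    intro f hf
    rw [← card_filter_univ_ne_zero hk hf, add_comm,
      ← Finset.card_filter_add_card_filter_not (s := ({v : V | f v ≠ 0} : Finset V)) (· ∈ S)]
    congr 2
    · ext v
      simp [and_comm]
    · ext v
      simp only [Finset.mem_filter, Finset.mem_univ, true_and]
      refine ⟨fun h => ⟨h.2, h.1.2⟩, fun h => ⟨⟨?_, h.2⟩, h.1⟩⟩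
      rintro rfl
      -- The zero vector lies in neither set, but it is never off a kernel, so the two counts still
      -- add up to that of the whole space.
      exact h.1 (map_zero f)
  have hw : ∀ {f : V →ₗ[F] F} {w w' : ℕ}, f ≠ 0 → w + w' = Fintype.card F ^ k →
      Finset.card {s ∈ S | f s ≠ 0} = (Fintype.card F - 1) * w →
      Finset.card {s ∈ ({v | v ≠ 0 ∧ v ∉ S} : Finset V) | f s ≠ 0} =
        (Fintype.card F - 1) * w' := by
    intro f w w' hf hw hc
    have := hcount f hf
    rw [hc, ← hw, mul_add, add_comm] at this
    exact Nat.add_left_cancel this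
  refine ⟨({v | v ≠ 0 ∧ v ∉ S} : Finset V), ⟨by simp, ?_, ?_, ⟨f₁, hf₁0, hw hf₁0 h₁ hf₁⟩,
    ⟨f₂, hf₂0, hw hf₂0 h₂ hf₂⟩⟩, ?_⟩
  · intro c v hv
    rw [Finset.mem_filter] at hv ⊢
    refine ⟨Finset.mem_univ _, (smul_ne_zero_iff_ne c).2 hv.2.1, fun h => hv.2.2 ?_⟩
    simpa using hsmul c⁻¹ _ h
  · intro f hf0
    exact (hf f hf0).imp (hw hf0 h₁) (hw hf0 h₂)
  · have : ({v | v ≠ 0 ∧ v ∉ S} : Finset V) = (insert 0 S)ᶜ := by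
      ext v
      simp
    rw [this, ← hk, ← Module.card_eq_pow_finrank (K := F) (V := V), add_assoc,
      ← Finset.card_insert_of_notMem h0, Finset.card_compl_add_card]

/-- The number `1 + q ^ m + ⋯ + q ^ (m (i - 1))` of points of a projective space. -/
def pointCount (q m i : ℕ) : ℕ := ∑ j ∈ Finset.range i, (q ^ m) ^ j

theorem pointCount_mul {R : Type*} [CommRing R] (q m i : ℕ) :
    (pointCount q m i : R) * ((q : R) ^ m - 1) = (q : R) ^ (m * i) - 1 := by
  rw [pointCount, pow_mul]
  push_cast
  exact geom_sum_mul _ _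

theorem exists_submodule_finrank_eq [Module.Finite F V] {r : ℕ} (hr : r ≤ Module.finrank F V) :
    ∃ U : Submodule F V, Module.finrank F U = r := by
  have b := Module.finBasis F V
  have hli : LinearIndependent F (b ∘ Fin.castLE hr) :=
    b.linearIndependent.comp _ (Fin.castLE_injective hr)
  exact ⟨_, (finrank_span_eq_card hli).trans (Fintype.card_fin r)⟩

/-- The value r = 0, with U = 0 and second weight 0, is included because the complement construction
uses m - r in place of r, which is 0 when r = m. -/
theorem exists_isTwoWeightSet (F : Type*) [Field F] [Fintype F] [DecidableEq F] {q m l r : ℕ}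
    (hq : Fintype.card F = q) (hm : 1 ≤ m) (hl : 1 ≤ l) (hrm : r ≤ m) :
    ∃ (V : Type) (_ : AddCommGroup V) (_ : Module F V) (_ : Module.Finite F V) (S : Finset V),
      Module.finrank F V = m * (2 * l + 1) ∧
      S.card = (q ^ (m * l) - 1) * (1 + (q ^ r - 1) * pointCount q m (l + 1)) ∧
      IsTwoWeightSet F S
        ((q ^ r - 1) * pointCount q m l * q ^ (m * (l + 1) - 1) + q ^ (m * l + r - 1))
        ((q ^ r - 1) * pointCount q m l * q ^ (m * (l + 1) - 1)) := by
  classical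
  obtain ⟨p, hp⟩ := CharP.exists F
  have : Fact p.Prime := ⟨CharP.char_is_prime F p⟩
  have : NeZero m := ⟨by omega⟩
  have : NeZero l := ⟨by omega⟩
  let K := FiniteField.Extension F p m
  have : CharP K p := charP_of_injective_algebraMap (algebraMap F K).injective p
  let A := FiniteField.Extension K p l
  let B := FiniteField.Extension K p (l + 1)
  -- The F-structures on A and B are defined through K so that the towers commute by definition.
  let _ : Algebra F A := ((algebraMap K A).comp (algebraMap F K)).toAlgebra
  let _ : Algebra F B := ((algebraMap K B).comp (algebraMap F K)).toAlgebra
  have : IsScalarTower F K A := .of_algebraMap_eq' rfl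
  have : IsScalarTower F K B := .of_algebraMap_eq' rfl
  have : Fintype K := Fintype.ofFinite _
  have : Fintype A := Fintype.ofFinite _
  have : Fintype B := Fintype.ofFinite _
  have hK : Module.finrank F K = m := FiniteField.finrank_extension F p m
  have hKA : Module.finrank K A = l := FiniteField.finrank_extension K p l
  have hKB : Module.finrank K B = l + 1 := FiniteField.finrank_extension K p (l + 1)
  have hFA : Module.finrank F A = m * l := by rw [← Module.finrank_mul_finrank F K A, hK, hKA]
  have hFB : Module.finrank F B = m * (l + 1) := by
    rw [← Module.finrank_mul_finrank F K B, hK, hKB]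
  have hdeg : Module.finrank K B = Module.finrank K A + 1 := by rw [hKA, hKB]
  obtain ⟨U, hU⟩ := exists_submodule_finrank_eq (F := F) (V := K) (hrm.trans hK.ge)
  have hcF : (Fintype.card F : ℂ) = q := by rw [hq]
  have hcK : (Fintype.card K : ℂ) = (q : ℂ) ^ m := by
    rw [Module.card_eq_pow_finrank (K := F) (V := K), hK, hq, Nat.cast_pow]
  have hcA : (Fintype.card A : ℂ) = (q : ℂ) ^ (m * l) := by
    rw [Module.card_eq_pow_finrank (K := F) (V := A), hFA, hq, Nat.cast_pow]
  have hcB : (Fintype.card B : ℂ) = (q : ℂ) ^ (m * (l + 1)) := by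
    rw [Module.card_eq_pow_finrank (K := F) (V := B), hFB, hq, Nat.cast_pow]
  have hcU : (Fintype.card U : ℂ) = (q : ℂ) ^ r := by
    rw [Module.card_eq_pow_finrank (K := F) (V := U), hU, hq, Nat.cast_pow]
  have hκA : normFiberCard K A = pointCount q m l := by
    refine mul_right_cancel₀ (card_sub_one_ne_zero (K := K)) ?_
    rw [normFiberCard_mul, hcA, hcK, pointCount_mul]
  have hκB : normFiberCard K B = pointCount q m (l + 1) := by
    refine mul_right_cancel₀ (card_sub_one_ne_zero (K := K)) ?_
    rw [normFiberCard_mul, hcB, hcK, pointCount_mul]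
  have hq0 : 0 < q := hq ▸ Fintype.card_pos
  have hqC : (q : ℂ) ≠ 0 := by exact_mod_cast hq0.ne'
  have hpow : ∀ i, 1 ≤ q ^ i := fun i => Nat.one_le_pow _ _ hq0
  have hsub : ∀ i, ((q ^ i - 1 : ℕ) : ℂ) = (q : ℂ) ^ i - 1 := fun i => by
    rw [Nat.cast_sub (hpow i), Nat.cast_pow, Nat.cast_one]
  have hml : 1 ≤ m * l := Nat.mul_pos hm hl
  have e1 : (q : ℂ) ^ (m * (l + 1)) = q * q ^ (m * (l + 1) - 1) := by
    rw [← pow_succ', Nat.sub_add_cancel (Nat.mul_pos hm l.succ_pos)]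
  have e2 : (q : ℂ) ^ (m * l) * q ^ r = q * q ^ (m * l + r - 1) := by
    rw [← pow_succ', ← pow_add, Nat.sub_add_cancel (by omega)]
  obtain ⟨h1, h2, h3⟩ := card_normCone_filter (A := A) (B := B) hdeg U
  have hZ₁ : ∀ {Z : ℕ}, (Fintype.card F : ℂ) * Z =
      ((Fintype.card F : ℂ) - 1) * (((Fintype.card U : ℂ) - 1) * normFiberCard K A *
          Fintype.card B + Fintype.card A * Fintype.card U) →
      Z = (Fintype.card F - 1) * ((q ^ r - 1) * pointCount q m l * q ^ (m * (l + 1) - 1) +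
        q ^ (m * l + r - 1)) := by
    intro Z h
    rw [hκA, hcF, hcU, hcB, hcA, e1, e2] at h
    refine Nat.cast_injective (R := ℂ) (mul_left_cancel₀ hqC (h.trans ?_))
    rw [hq]
    push_cast [Nat.cast_sub hq0, hsub]
    ring
  have hZ₂ : ∀ {Z : ℕ}, (Fintype.card F : ℂ) * Z =
      ((Fintype.card F : ℂ) - 1) * (((Fintype.card U : ℂ) - 1) * normFiberCard K A *
          Fintype.card B) →
      Z = (Fintype.card F - 1) * ((q ^ r - 1) * pointCount q m l * q ^ (m * (l + 1) - 1)) := by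
    intro Z h
    rw [hκA, hcF, hcU, hcB, e1] at h
    refine Nat.cast_injective (R := ℂ) (mul_left_cancel₀ hqC (h.trans ?_))
    rw [hq]
    push_cast [Nat.cast_sub hq0, hsub]
    ring
  refine ⟨A × B, inferInstance, inferInstance, inferInstance, normCone A B U, ?_, ?_, ?_,
    smul_mem_normCone hdeg U, ?_, ?_, ?_⟩
  · rw [Module.finrank_prod, hFA, hFB]
    ring
  · refine Nat.cast_injective (R := ℂ) ?_
    rw [card_normCone, hκB, hcU, hcA]
    push_cast [hsub]
    ring
  · simp [mem_normCone]
  · exact fun f hf => (h1 f hf).imp hZ₁ hZ₂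
  · obtain ⟨f, hf, h⟩ := h2
    exact ⟨f, hf, hZ₁ h⟩
  · obtain ⟨f, hf, h⟩ := h3
    exact ⟨f, hf, hZ₂ h⟩

theorem IsTwoWeightSet.exists_code [Module.Finite F V] {k : ℕ} (hk : Module.finrank F V = k)
    {S : Finset V} {w₁ w₂ : ℕ} (hS : IsTwoWeightSet F S w₁ w₂) (hw : w₁ ≠ w₂) (hw₁ : w₁ ≠ 0)
    (hw₂ : w₂ ≠ 0) :
    ∃ n : ℕ, (Fintype.card F - 1) * n = S.card ∧
      ∃ C : Submodule F (Fin n → F), IsProjectiveTwoWeightCode k C w₁ w₂ := by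
  obtain ⟨h0, hsmul, hf, ⟨f₁, -, hf₁⟩, ⟨f₂, -, hf₂⟩⟩ := hS
  exact exists_isProjectiveTwoWeightCode hk S h0 hsmul hw hw₁ hw₂ hf ⟨f₁, hf₁⟩ ⟨f₂, hf₂⟩

end TwoWeightSets


/-! ### Matching the counts with the stated parameters. -/

section Parameters

/-- The exponents in the parameters, expressed through `q ^ (m * l - 1)`, `q ^ r` and
`q ^ (m - r)`. -/
theorem pow_exponents {R : Type*} [CommRing R] (x : R) {m l r : ℕ} (hm : 1 ≤ m) (hl : 1 ≤ l)
    (hrm : r ≤ m) :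
    x ^ m = x ^ r * x ^ (m - r) ∧ x ^ (m * l) = x * x ^ (m * l - 1) ∧
    x ^ (m * (l + 1)) = x * x ^ (m * l - 1) * (x ^ r * x ^ (m - r)) ∧
    x ^ (m * (l + 1) - 1) = x ^ (m * l - 1) * (x ^ r * x ^ (m - r)) ∧
    x ^ (m * l + r - 1) = x ^ (m * l - 1) * x ^ r ∧
    x ^ (m * l + (m - r) - 1) = x ^ (m * l - 1) * x ^ (m - r) ∧
    x ^ (m * (l + 1) + r) = x * x ^ (m * l - 1) * (x ^ r * x ^ (m - r)) * x ^ r ∧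
    x ^ (m * (l + 1) - r) = x * x ^ (m * l - 1) * x ^ (m - r) ∧
    x ^ (m * (l + 1) - r - 1) = x ^ (m * l - 1) * x ^ (m - r) ∧
    x ^ (m * (2 * l + 1) - 1) =
      x * x ^ (m * l - 1) * x ^ (m * l - 1) * (x ^ r * x ^ (m - r)) ∧
    x ^ (m * (2 * l + 1)) =
      x * x * x ^ (m * l - 1) * x ^ (m * l - 1) * (x ^ r * x ^ (m - r)) := by
  have hml : 1 ≤ m * l := Nat.mul_pos hm hl
  have h1 : m * (l + 1) = m * l + m := by ring
  have h2 : m * (2 * l + 1) = m * l + m * l + m := by ring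
  rw [h1, h2]
  generalize m * l = e at *
  refine ⟨?_, ?_, ?_, ?_, ?_, ?_, ?_, ?_, ?_, ?_, ?_⟩ <;>
  · simp only [← pow_add, ← pow_succ', mul_assoc]
    congr 1
    omega

variable {q m l r : ℕ}

theorem pow_sub_one_ne_zero_of_two_le (hq : 2 ≤ q) (hm : 1 ≤ m) : (q : ℚ) ^ m - 1 ≠ 0 := by
  have : (1 : ℚ) < (q : ℚ) ^ m := one_lt_pow₀ (by exact_mod_cast hq) (by omega)
  exact (sub_pos.2 this).ne'

theorem cast_pow_sub_one (hq : 2 ≤ q) (i : ℕ) : ((q ^ i - 1 : ℕ) : ℚ) = (q : ℚ) ^ i - 1 := by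
  rw [Nat.cast_sub (Nat.one_le_pow _ _ (by omega)), Nat.cast_pow, Nat.cast_one]

/-- The larger weight for m - r and the smaller complementary weight add up to the number of points
off a hyperplane of the whole space, as `IsTwoWeightSet.exists_compl` requires. -/
theorem weight_add_weight (hq : 2 ≤ q) (hm : 1 ≤ m) (hl : 1 ≤ l) (hrm : r ≤ m) :
    (q ^ (m - r) - 1) * pointCount q m l * q ^ (m * (l + 1) - 1) + q ^ (m * l + (m - r) - 1) +
      (q ^ r - 1) * pointCount q m (l + 1) * q ^ (m * (l + 1) - r - 1) =
      q ^ (m * (2 * l + 1) - 1) := by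
  refine Nat.cast_injective (R := ℚ) ?_
  push_cast [cast_pow_sub_one hq]
  have hG := pointCount_mul (R := ℚ) q m l
  have hG' := pointCount_mul (R := ℚ) q m (l + 1)
  have hD := pow_sub_one_ne_zero_of_two_le hq hm
  obtain ⟨e1, e2, e3, e4, e5, e6, e7, e8, e9, e10, e11⟩ := pow_exponents (q : ℚ) hm hl hrm
  rw [e1, e2] at hG
  rw [e1, e3] at hG'
  rw [e1] at hD
  rw [e4, e6, e9, e10]
  refine mul_right_cancel₀ hD ?_
  generalize (q : ℚ) ^ (m * l - 1) = P at *
  generalize (q : ℚ) ^ r = R at *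
  generalize (q : ℚ) ^ (m - r) = T at *
  linear_combination (T - 1) * P * R * T * hG + (R - 1) * P * T * hG'

theorem codeLength_eq (hq : 2 ≤ q) (hm : 1 ≤ m) {n : ℕ}
    (hn : (q - 1) * n = (q ^ (m * l) - 1) * (1 + (q ^ r - 1) * pointCount q m (l + 1))) :
    (n : ℚ) = codeLength q m l r := by
  have hn := congrArg (Nat.cast (R := ℚ)) hn
  push_cast [cast_pow_sub_one hq, Nat.cast_sub (by omega : 1 ≤ q)] at hn
  have hG' := pointCount_mul (R := ℚ) q m (l + 1)
  have hD := pow_sub_one_ne_zero_of_two_le hq hm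
  have hD1 := pow_sub_one_ne_zero_of_two_le hq le_rfl
  rw [pow_one] at hD1
  rw [codeLength]
  field_simp
  linear_combination ((q : ℚ) ^ m - 1) * hn +
    ((q : ℚ) ^ (m * l) - 1) * ((q : ℚ) ^ r - 1) * hG'

theorem codeWeightTwo_eq (hq : 2 ≤ q) (hm : 1 ≤ m) :
    (((q ^ r - 1) * pointCount q m l * q ^ (m * (l + 1) - 1) : ℕ) : ℚ) =
      codeWeightTwo q m l r := by
  push_cast [cast_pow_sub_one hq]
  have hG := pointCount_mul (R := ℚ) q m l
  have hD := pow_sub_one_ne_zero_of_two_le hq hm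
  rw [codeWeightTwo, eq_div_iff hD]
  linear_combination ((q : ℚ) ^ r - 1) * (q : ℚ) ^ (m * (l + 1) - 1) * hG

theorem codeWeightOne_eq (hq : 2 ≤ q) (hm : 1 ≤ m) (hl : 1 ≤ l) (hrm : r ≤ m) :
    (((q ^ r - 1) * pointCount q m l * q ^ (m * (l + 1) - 1) + q ^ (m * l + r - 1) : ℕ) : ℚ) =
      codeWeightOne q m l r := by
  push_cast [cast_pow_sub_one hq]
  have hG := pointCount_mul (R := ℚ) q m l
  have hD := pow_sub_one_ne_zero_of_two_le hq hm
  rw [codeWeightOne, eq_div_iff hD]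
  obtain ⟨e1, e2, e3, e4, e5, e6, e7, e8, e9, e10, e11⟩ := pow_exponents (q : ℚ) hm hl hrm
  rw [e1, e2] at hG
  rw [e1, e3, e4, e5, e7]
  linear_combination ((q : ℚ) ^ r - 1) * (q : ℚ) ^ (m * l - 1) *
    ((q : ℚ) ^ r * (q : ℚ) ^ (m - r)) * hG

theorem dualCodeLength_eq (hq : 2 ≤ q) (hm : 1 ≤ m) (hl : 1 ≤ l) (hrm : r ≤ m) {n : ℕ}
    (hn : (q - 1) * n +
      (q ^ (m * l) - 1) * (1 + (q ^ (m - r) - 1) * pointCount q m (l + 1)) + 1 =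
      q ^ (m * (2 * l + 1))) :
    (n : ℚ) = dualCodeLength q m l r := by
  have hn := congrArg (Nat.cast (R := ℚ)) hn
  push_cast [cast_pow_sub_one hq, Nat.cast_sub (by omega : 1 ≤ q)] at hn
  have hG' := pointCount_mul (R := ℚ) q m (l + 1)
  have hD := pow_sub_one_ne_zero_of_two_le hq hm
  have hD1 := pow_sub_one_ne_zero_of_two_le hq le_rfl
  rw [pow_one] at hD1
  obtain ⟨e1, e2, e3, e4, e5, e6, e7, e8, e9, e10, e11⟩ := pow_exponents (q : ℚ) hm hl hrm
  rw [dualCodeLength, div_add_div _ _ (mul_ne_zero hD1 hD) hD1,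
    eq_div_iff (mul_ne_zero (mul_ne_zero hD1 hD) hD1)]
  rw [e1, e3] at hG'
  rw [e2, e11] at hn
  rw [e1, e2, e3]
  generalize (q : ℚ) ^ (m * l - 1) = P at *
  generalize (q : ℚ) ^ r = R at *
  generalize (q : ℚ) ^ (m - r) = T at *
  linear_combination ((q : ℚ) - 1) * (R * T - 1) * hn -
    ((q : ℚ) - 1) * (q * P - 1) * (T - 1) * hG'

theorem dualCodeWeightTwo_eq (hq : 2 ≤ q) (hm : 1 ≤ m) (hl : 1 ≤ l) (hrm : r ≤ m) :
    (((q ^ r - 1) * pointCount q m (l + 1) * q ^ (m * (l + 1) - r - 1) : ℕ) : ℚ) =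
      dualCodeWeightTwo q m l r := by
  push_cast [cast_pow_sub_one hq]
  have hG' := pointCount_mul (R := ℚ) q m (l + 1)
  have hD := pow_sub_one_ne_zero_of_two_le hq hm
  have hD1 := pow_sub_one_ne_zero_of_two_le hq le_rfl
  rw [pow_one] at hD1
  obtain ⟨e1, e2, e3, e4, e5, e6, e7, e8, e9, e10, e11⟩ := pow_exponents (q : ℚ) hm hl hrm
  rw [dualCodeWeightTwo, eq_div_iff (mul_ne_zero hD1 hD), e8, e9]
  linear_combination ((q : ℚ) - 1) * ((q : ℚ) ^ r - 1) *
    ((q : ℚ) ^ (m * l - 1) * (q : ℚ) ^ (m - r)) * hG'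

theorem dualCodeWeightOne_eq (hq : 2 ≤ q) (hm : 1 ≤ m) (hl : 1 ≤ l) (hrm : r ≤ m) :
    (((q ^ r - 1) * pointCount q m (l + 1) * q ^ (m * (l + 1) - r - 1) +
      q ^ (m * l + (m - r) - 1) : ℕ) : ℚ) = dualCodeWeightOne q m l r := by
  push_cast [cast_pow_sub_one hq]
  have hG' := pointCount_mul (R := ℚ) q m (l + 1)
  have hD := pow_sub_one_ne_zero_of_two_le hq hm
  obtain ⟨e1, e2, e3, e4, e5, e6, e7, e8, e9, e10, e11⟩ := pow_exponents (q : ℚ) hm hl hrm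
  rw [dualCodeWeightOne, eq_div_iff hD, e7, e9, e6]
  rw [e3] at hG'
  rw [e3]
  rw [e1] at hG' ⊢
  linear_combination ((q : ℚ) ^ r - 1) *
    ((q : ℚ) ^ (m * l - 1) * (q : ℚ) ^ (m - r)) * hG'

theorem bierbrauerEdel_parameters (hq : 2 ≤ q) (hm : 1 ≤ m) (hrm : r ≤ m) :
    codeLength q m 1 r =
      (q : ℚ) ^ r * ((q : ℚ) ^ m - 1) * ((q : ℚ) ^ m - (q : ℚ) ^ (m - r) + 1) / ((q : ℚ) - 1) ∧
    codeWeightOne q m 1 r =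
      (q : ℚ) ^ (m + r - 1) * ((q : ℚ) ^ m - (q : ℚ) ^ (m - r) + 1) ∧
    codeWeightTwo q m 1 r = (q : ℚ) ^ (2 * m + r - 1) - (q : ℚ) ^ (2 * m - 1) := by
  have hD := pow_sub_one_ne_zero_of_two_le hq hm
  have hD1 := pow_sub_one_ne_zero_of_two_le hq le_rfl
  rw [pow_one] at hD1
  obtain ⟨e1, e2, e3, e4, e5, e6, e7, e8, e9, e10, e11⟩ := pow_exponents (q : ℚ) hm le_rfl hrm
  have e12 : (q : ℚ) ^ (2 * m + r - 1) = (q : ℚ) ^ (m * (1 + 1) - 1) * (q : ℚ) ^ r := by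
    rw [← pow_add]
    congr 1
    omega
  have e13 : (q : ℚ) ^ (2 * m - 1) = (q : ℚ) ^ (m * (1 + 1) - 1) := by rw [mul_comm]
  have e14 : (q : ℚ) ^ m = q * (q : ℚ) ^ (m * 1 - 1) := by rw [← e2, mul_one]
  have e15 : (q : ℚ) ^ (m * (1 + 1)) = (q : ℚ) ^ m * (q : ℚ) ^ m := by rw [← pow_add]; ring_nf
  refine ⟨?_, ?_, ?_⟩
  · rw [codeLength, e15, mul_one]
    field_simp
    rw [e1]
    ring
  · rw [codeWeightOne, div_eq_iff hD, pow_add, e15, mul_one, ← mul_one m, e5, mul_one]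
    rw [e1]
    ring
  · rw [codeWeightTwo, div_eq_iff hD, e12, e13, mul_one]
    ring

end Parameters

/-! ### Assembly of the two families. -/

theorem mainTheorem4 {F : Type*} [Field F] [Fintype F] [DecidableEq F]
    (q m ℓ r : ℕ) (hq : Fintype.card F = q) (hm : 1 ≤ m) (hℓ : 1 ≤ ℓ)
    (hr : 1 ≤ r) (hrm : r ≤ m) :
    (∃ n w₁ w₂ : ℕ,
      (n : ℚ) = codeLength q m ℓ r ∧
      (w₁ : ℚ) = codeWeightOne q m ℓ r ∧
      (w₂ : ℚ) = codeWeightTwo q m ℓ r ∧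
      ∃ C : Submodule F (Fin n → F),
        IsProjectiveTwoWeightCode (m * (2 * ℓ + 1)) C w₁ w₂) ∧
    (∃ n w₁ w₂ : ℕ,
      (n : ℚ) = dualCodeLength q m ℓ r ∧
      (w₁ : ℚ) = dualCodeWeightOne q m ℓ r ∧
      (w₂ : ℚ) = dualCodeWeightTwo q m ℓ r ∧
      ∃ C : Submodule F (Fin n → F),
        IsProjectiveTwoWeightCode (m * (2 * ℓ + 1)) C w₁ w₂) ∧
    (ℓ = 1 →
      codeLength q m ℓ r =
        (q : ℚ) ^ r * ((q : ℚ) ^ m - 1) * ((q : ℚ) ^ m - (q : ℚ) ^ (m - r) + 1) / ((q : ℚ) - 1) ∧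
      m * (2 * ℓ + 1) = 3 * m ∧
      codeWeightOne q m ℓ r =
        (q : ℚ) ^ (m + r - 1) * ((q : ℚ) ^ m - (q : ℚ) ^ (m - r) + 1) ∧
      codeWeightTwo q m ℓ r = (q : ℚ) ^ (2 * m + r - 1) - (q : ℚ) ^ (2 * m - 1)) := by
  have hq2 : 2 ≤ q := hq ▸ Fintype.one_lt_card
  have hq0 : 0 < q := by omega
  have hsub : ∀ {i}, 1 ≤ i → 0 < q ^ i - 1 := fun hi =>
    Nat.sub_pos_of_lt (Nat.one_lt_pow (by omega) hq2)
  have hpc : ∀ i, 0 < pointCount q m (i + 1) := fun i =>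
    Finset.sum_pos (fun j _ => by positivity) ⟨0, by simp⟩
  refine ⟨?_, ?_, ?_⟩
  · obtain ⟨V, _, _, _, S, hV, hcard, hS⟩ := exists_isTwoWeightSet F hq hm hℓ hrm
    have hw₂ : 0 < (q ^ r - 1) * pointCount q m ℓ * q ^ (m * (ℓ + 1) - 1) := by
      have := hpc (ℓ - 1)
      rw [Nat.sub_add_cancel hℓ] at this
      have := hsub hr
      positivity
    have hpos : 0 < q ^ (m * ℓ + r - 1) := by positivity
    obtain ⟨n, hn, hC⟩ := hS.exists_code hV (by omega) (by omega) (by omega)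
    rw [hq, hcard] at hn
    exact ⟨n, _, _, codeLength_eq hq2 hm hn, codeWeightOne_eq hq2 hm hℓ hrm,
      codeWeightTwo_eq hq2 hm, hC⟩
  · obtain ⟨V, _, _, _, S, hV, hcard, hS⟩ :=
      exists_isTwoWeightSet F hq hm hℓ (Nat.sub_le m r)
    have hk : m * (2 * ℓ + 1) = (m * (2 * ℓ + 1) - 1) + 1 :=
      (Nat.sub_add_cancel (Nat.mul_pos hm (Nat.succ_pos _))).symm
    have hadd := weight_add_weight (r := r) hq2 hm hℓ hrm
    have hw₂ : 0 < (q ^ r - 1) * pointCount q m (ℓ + 1) * q ^ (m * (ℓ + 1) - r - 1) := by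
      have := hpc ℓ
      have := hsub hr
      positivity
    have hpos : 0 < q ^ (m * ℓ + (m - r) - 1) := by positivity
    obtain ⟨T, hT, hTcard⟩ := hS.exists_compl (hV.trans hk)
      (w₁' := (q ^ r - 1) * pointCount q m (ℓ + 1) * q ^ (m * (ℓ + 1) - r - 1))
      (w₂' := (q ^ r - 1) * pointCount q m (ℓ + 1) * q ^ (m * (ℓ + 1) - r - 1) +
        q ^ (m * ℓ + (m - r) - 1)) (by rw [hq, hadd]) (by rw [hq, ← hadd]; ring)
    obtain ⟨n, hn, C, hCk, hCy, hCw⟩ := hT.exists_code hV (by omega) (by omega) (by omega)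
    rw [← hn, hcard, hq, ← hk] at hTcard
    -- Complementation reverses the order of the weights, so the pair has to be swapped back.
    refine ⟨n, _, _, dualCodeLength_eq hq2 hm hℓ hrm hTcard, dualCodeWeightOne_eq hq2 hm hℓ hrm,
      dualCodeWeightTwo_eq hq2 hm hℓ hrm, C, hCk, hCy, hCw.1.symm, ?_⟩
    rw [hCw.2, Set.pair_comm]
  · rintro rfl
    obtain ⟨h1, h2, h3⟩ := bierbrauerEdel_parameters hq2 hm hrm
    exact ⟨h1, by ring, h2, h3⟩
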